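/- Let $G=(V,D,B)$ be a mixed graph: $V$ is a finite set of nodes, $D\subseteq V\times V$ is the set of directed edges $v\to w$, $B$ is the symmetric set of bidirected edges $v\leftrightarrow w$, and there are no self-loops. Put $\mathrm{pa}(v)=\{w: w\to v\in D\}$ and $\mathrm{sib}(v)=\{w: w\leftrightarrow v\in B\}$. A half-trek from $y$ to $k$ is a path $y\to x_1\to\cdots\to x_m=k$ with $m\ge 0$ (right-hand side $\{y,x_1,\dots,x_m\}$) or a path $y\leftrightarrow x_0\to x_1\to\cdots\to x_m=k$ with $m\ge 0$ (right-hand side $\{x_0,\dots,x_m\}$); its left-hand side is $\{y\}$, and nodes may be repeated. A set $Y\subseteq V$ satisfies the half-trek criterion with respect to $v$ if $|Y|=|\mathrm{pa}(v)|$, $Y\cap(\{v\}\cup\mathrm{sib}(v))=\varnothing$, and there is a set of half-treks whose sources are distinct and form $Y$, whose targets are distinct and form $\mathrm{pa}(v)$, and whose left-hand sides, and also right-hand sides, are pairwise disjoint. The graph $G$ is HTC-infinite-to-one if every family $(Y_v: v\in V)$ of subsets of $V$ contains a set $Y_v$ that fails the half-trek criterion with respect to $v$, or a pair of sets $Y_v,Y_w$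 with $v\in Y_w$ and $w\in Y_v$. Let $G_{\mathrm{flow}}$ be the following network. Its nodes are a source $s$, a sink $t$, a node $L\{v,w\}$ for each unordered pair of distinct nodes $v,w\in V$ with $v\leftrightarrow w\notin B$, and a node $R_v(w)$ for all $v,w\in V$. Its edges are $s\to L\{v,w\}$, $L\{v,w\}\to R_v(w)$ and $L\{v,w\}\to R_w(v)$ for each such pair; $L\{v,w\}\to R_v(u)$ for each such pair, in either order of $v$ and $w$, and each $u$ with $w\leftrightarrow u\in B$; $R_v(w)\to R_v(u)$ for $v\in V$ and $w\to u\in D$; and $R_v(w)\to t$ for $w\in\mathrm{pa}(v)$. All edges and the nodes $s,t$ have capacity $\infty$; all other nodes have capacity $1$. A flow is a function $f\ge 0$ on the edges with values in $\mathbb R$ that is conserved at every node other than $s$ and $t$ and respects the node and edge capacities; its size is $\sum_x f(s,x)$, and the max-flow problem is to find a flow of maximum size. Then $G$ is HTC-infinite-to-one if and only if $G_{\mathrm{flow}}$ has maximum flow size strictly less than $|D|=\sum_{v\in V}|\mathrm{pa}(v)|$. Moreover, the computational complexity of solving this max-flow problem is $\mathcal O(|V|^3(|V|+r)^3)$, where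 $r\le|D|/2$ is the number of reciprocal edge pairs of $G$, that is, of unordered pairs of distinct nodes $v,w$ with $v\to w\in D$ and $w\to v\in D$: there are a fixed program of a unit-cost random access machine (with addition, truncated subtraction, indirect addressing and zero tests on natural numbers) and a constant $C$ such that, for every $G$ with $V\ne\varnothing$ and every numbering of the nodes of $G_{\mathrm{flow}}$, the program, given $G_{\mathrm{flow}}$ by its node capacities and its adjacency matrix with edge capacities, halts with a maximum flow and its size after at most $C\,|V|^3(|V|+r)^3$ steps. -/

import Mathlib

open scoped NNReal ENNReal

universe u

/-! ## Mixed graphs, treks and the half-trek criterion -/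

/-- A mixed graph on the node set `V`: directed edges `v → w` and (symmetric) bidirected
edges `v ↔ w`, both without self-loops. Directed cycles, and several edges of different kinds
between two nodes, are allowed. -/
structure MixedGraph (V : Type u) where
  /-- `dir v w` means `v → w ∈ D`. -/
  dir : V → V → Prop
  /-- `bidir v w` means `v ↔ w ∈ B`. -/
  bidir : V → V → Prop
  dir_irrefl : ∀ v, ¬ dir v v
  bidir_irrefl : ∀ v, ¬ bidir v v
  bidir_symm : ∀ v w, bidir v w → bidir w v

namespace MixedGraph

variable {V : Type u} (G : MixedGraph V)

/-- The set of parents of `v`. -/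
def pa (v : V) : Set V := {w | G.dir w v}

/-- The set of siblings of `v`. -/
def sib (v : V) : Set V := {w | G.bidir w v}

/-- The number `|D|` of directed edges. -/
noncomputable def numDirected : ℕ := {p : V × V | G.dir p.1 p.2}.ncard

/-- The number `r` of reciprocal edge pairs: unordered pairs of distinct nodes `v, w` such that
both `v → w` and `w → v` are edges. -/
noncomputable def numReciprocal : ℕ :=
  {z : Sym2 V | ∃ v w, v ≠ w ∧ G.dir v w ∧ G.dir w v ∧ z = s(v, w)}.ncard

/-- A trek
`vL_l ← ⋯ ← vL_1 ← vL_0 ↔ vR_0 → vR_1 → ⋯ → vR_r` or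
`vL_l ← ⋯ ← vL_1 ← vT → vR_1 → ⋯ → vR_r`,
given by the lists `[vL_0, …, vL_l]`, `[vR_0, …, vR_r]`, with `vL_0 = vR_0 = vT` in the second
case. Nodes may be repeated. -/
@[ext]
structure Trek where
  leftList : List V
  rightList : List V
  left_ne_nil : leftList ≠ []
  right_ne_nil : rightList ≠ []
  left_chain : leftList.IsChain G.dir
  right_chain : rightList.IsChain G.dir
  join : leftList.head left_ne_nil = rightList.head right_ne_nil ∨
    G.bidir (leftList.head left_ne_nil) (rightList.head right_ne_nil)

namespace Trek

variable {G} (π : G.Trek)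

/-- The source of a trek. -/
def source : V := π.leftList.getLast π.left_ne_nil

/-- The target of a trek. -/
def target : V := π.rightList.getLast π.right_ne_nil

/-- The left-hand side `Left(π)`. -/
def left : Set V := {x | x ∈ π.leftList}

/-- The right-hand side `Right(π)`. -/
def right : Set V := {x | x ∈ π.rightList}

/-- A half-trek is a trek with `|Left(π)| = 1`. -/
def IsHalfTrek : Prop := π.left.ncard = 1

end Trek

/-- `T` is a system of treks from `X` to `Y`: the sources are distinct and form `X`, and the
targets are distinct and form `Y`. -/
def IsTrekSystem (T : Set G.Trek) (X Y : Set V) : Prop :=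
  Set.BijOn Trek.source T X ∧ Set.BijOn Trek.target T Y

/-- A set of treks has no sided intersection if the left-hand sides are pairwise disjoint and the
right-hand sides are pairwise disjoint. -/
def NoSidedIntersection (T : Set G.Trek) : Prop :=
  ∀ π ∈ T, ∀ ρ ∈ T, π ≠ ρ → Disjoint π.left ρ.left ∧ Disjoint π.right ρ.right

/-- The set `Y` satisfies the half-trek criterion with respect to the node `v`. -/
def HalfTrekCriterion (v : V) (Y : Set V) : Prop :=
  Y.ncard = (G.pa v).ncard ∧
  Y ∩ ({v} ∪ G.sib v) = ∅ ∧
  ∃ T : Set G.Trek, G.IsTrekSystem T Y (G.pa v) ∧ (∀ π ∈ T, π.IsHalfTrek) ∧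
    G.NoSidedIntersection T

/-- `G` is HTC-infinite-to-one: every family `(Y_v : v ∈ V)` of subsets of `V` contains a set
`Y_v` that fails the half-trek criterion with respect to `v`, or a pair of sets `Y_v, Y_w` with
`v ∈ Y_w` and `w ∈ Y_v`. -/
def HTCInfiniteToOne : Prop :=
  ∀ Y : V → Set V,
    (∃ v, ¬ G.HalfTrekCriterion v (Y v)) ∨ (∃ v w, v ∈ Y w ∧ w ∈ Y v)

end MixedGraph

/-! ## Flow networks and the max-flow problem -/

/-- A directed graph with a source, a sink, node capacities and edge capacities
(nonnegative reals or `∞`). -/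
structure FlowNetwork (N : Type u) where
  edge : N → N → Prop
  source : N
  sink : N
  nodeCap : N → ℝ≥0∞
  /-- Only the values on edges matter. -/
  edgeCap : N → N → ℝ≥0∞

namespace FlowNetwork

variable {N : Type u} [Fintype N] (F : FlowNetwork N)

/-- A flow: a nonnegative real function on the edges (extended by `0` to all pairs of nodes) that
is conserved and obeys the node capacity at every node other than source and sink, and obeys the
edge capacities. -/
def IsFlow (f : N → N → ℝ≥0) : Prop :=
  (∀ x y, ¬ F.edge x y → f x y = 0) ∧
  (∀ x, x ≠ F.source → x ≠ F.sink →
    ∑ y, f y x = ∑ y, f x y ∧ ((∑ y, f x y : ℝ≥0) : ℝ≥0∞) ≤ F.nodeCap x) ∧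
  (∀ x y, F.edge x y → (f x y : ℝ≥0∞) ≤ F.edgeCap x y)

/-- The size of a flow: the total amount that leaves the source. (The networks considered here
have no edge into the source.) -/
def size (f : N → N → ℝ≥0) : ℝ≥0 := ∑ y, f F.source y

/-- A solution of the max-flow problem: a flow of maximum size among all real-valued flows. -/
def IsMaxFlow (f : N → N → ℝ≥0) : Prop :=
  F.IsFlow f ∧ ∀ g, F.IsFlow g → F.size g ≤ F.size f

end FlowNetwork

/-! ## The network `G_flow` -/

namespace MixedGraph

variable {V : Type u} (G : MixedGraph V)

/-- Unordered pairs `{v, w}` of distinct nodes that are not siblings. -/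
def NonSiblingPair : Type u :=
  {z : Sym2 V // ∃ v w, v ≠ w ∧ ¬ G.bidir v w ∧ z = s(v, w)}

/-- The nodes of `G_flow`: `s`, `t`, the left-hand copies `L{v, w}` for all non-sibling pairs
`{v, w}`, and the right-hand copies `R_v(w)`, written `right v w`, for all `v, w`. -/
inductive FlowNode : Type u
  | source
  | sink
  | left (p : G.NonSiblingPair)
  | right (v w : V)

instance [Finite V] : Finite G.FlowNode := by
  have : Finite (Sym2 V) := Quot.finite _
  have : Finite G.NonSiblingPair := Subtype.finite
  let φ : G.FlowNode → Bool ⊕ G.NonSiblingPair ⊕ V × V := fun x =>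
    match x with
    | .source => .inl true
    | .sink => .inl false
    | .left p => .inr (.inl p)
    | .right v w => .inr (.inr (v, w))
  refine Finite.of_injective φ ?_
  intro x y h
  cases x <;> cases y <;> simp_all [φ]

noncomputable instance [Fintype V] : Fintype G.FlowNode := Fintype.ofFinite _

/-- The edges of `G_flow`. The pair `{v, w}` is unordered, so that `L{v, w}` has edges into the
copies `R_v` and `R_w`. -/
inductive FlowEdge : G.FlowNode → G.FlowNode → Prop
  /-- `s → L{v, w}` -/
  | source_left (p : G.NonSiblingPair) : FlowEdge .source (.left p)
  /-- `L{v, w} → R_v(w)` -/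
  | left_right (p : G.NonSiblingPair) (v w : V) (h : p.1 = s(v, w)) :
      FlowEdge (.left p) (.right v w)
  /-- `L{v, w} → R_v(u)` for `w ↔ u` -/
  | left_right_sib (p : G.NonSiblingPair) (v w x : V) (h : p.1 = s(v, w)) (hx : G.bidir w x) :
      FlowEdge (.left p) (.right v x)
  /-- `R_v(w) → R_v(u)` for `w → u` -/
  | right_right (v w x : V) (h : G.dir w x) : FlowEdge (.right v w) (.right v x)
  /-- `R_v(w) → t` for `w ∈ pa(v)` -/
  | right_sink (v w : V) (h : w ∈ G.pa v) : FlowEdge (.right v w) .sink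

/-- The flow network `G_flow`: all edges, the source and the sink have capacity `∞`, and all other
nodes have capacity `1`. -/
noncomputable def flowNetwork : FlowNetwork G.FlowNode where
  edge := G.FlowEdge
  source := .source
  sink := .sink
  nodeCap x := match x with
    | .source => ⊤
    | .sink => ⊤
    | .left _ => 1
    | .right _ _ => 1
  edgeCap _ _ := ⊤

end MixedGraph

/-! ## A random access machine with unit costs -/

/-- The state of the machine: registers and an indirectly addressed memory, holding natural
numbers. -/
structure RAMState where
  reg : ℕ → ℕ
  mem : ℕ → ℕ

/-- Programs of a random access machine, with structured control flow. A program mentions only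
finitely many registers; the only arithmetic is addition and (truncated) subtraction. -/
inductive RAMProgram : Type
  /-- do nothing -/
  | skip
  /-- `R_i := c` -/
  | const (i c : ℕ)
  /-- `R_i := R_j + R_k` -/
  | add (i j k : ℕ)
  /-- `R_i := R_j - R_k` (`0` if `R_j < R_k`) -/
  | sub (i j k : ℕ)
  /-- `R_i := M[R_j]` -/
  | load (i j : ℕ)
  /-- `M[R_i] := R_j` -/
  | store (i j : ℕ)
  /-- sequential composition -/
  | seq (P Q : RAMProgram)
  /-- `if R_i ≠ 0 then P else Q` -/
  | ite (i : ℕ) (P Q : RAMProgram)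
  /-- `while R_i ≠ 0 do P` -/
  | loop (i : ℕ) (P : RAMProgram)

namespace RAMState

/-- Overwrite a register. -/
def setReg (σ : RAMState) (i x : ℕ) : RAMState := ⟨Function.update σ.reg i x, σ.mem⟩

/-- Overwrite a memory cell. -/
def setMem (σ : RAMState) (a x : ℕ) : RAMState := ⟨σ.reg, Function.update σ.mem a x⟩

end RAMState

/-- `RAMExec P σ σ' k`: started in the state `σ`, the program `P` halts in the state `σ'` after
exactly `k` steps. Every instruction and every evaluation of a test costs one step. The execution
is deterministic: at most one pair `σ', k` is possible for given `P, σ`. -/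
inductive RAMExec : RAMProgram → RAMState → RAMState → ℕ → Prop
  | skip (σ : RAMState) : RAMExec .skip σ σ 1
  | const (σ : RAMState) (i c : ℕ) : RAMExec (.const i c) σ (σ.setReg i c) 1
  | add (σ : RAMState) (i j k : ℕ) :
      RAMExec (.add i j k) σ (σ.setReg i (σ.reg j + σ.reg k)) 1
  | sub (σ : RAMState) (i j k : ℕ) :
      RAMExec (.sub i j k) σ (σ.setReg i (σ.reg j - σ.reg k)) 1
  | load (σ : RAMState) (i j : ℕ) :
      RAMExec (.load i j) σ (σ.setReg i (σ.mem (σ.reg j))) 1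
  | store (σ : RAMState) (i j : ℕ) :
      RAMExec (.store i j) σ (σ.setMem (σ.reg i) (σ.reg j)) 1
  | seq {P Q : RAMProgram} {σ σ' σ'' : RAMState} {k l : ℕ} (hP : RAMExec P σ σ' k)
      (hQ : RAMExec Q σ' σ'' l) : RAMExec (.seq P Q) σ σ'' (k + l)
  | ite_true {i : ℕ} {P Q : RAMProgram} {σ σ' : RAMState} {k : ℕ} (h : σ.reg i ≠ 0)
      (hP : RAMExec P σ σ' k) : RAMExec (.ite i P Q) σ σ' (k + 1)
  | ite_false {i : ℕ} {P Q : RAMProgram} {σ σ' : RAMState} {k : ℕ} (h : σ.reg i = 0)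
      (hQ : RAMExec Q σ σ' k) : RAMExec (.ite i P Q) σ σ' (k + 1)
  | loop_true {i : ℕ} {P : RAMProgram} {σ σ' σ'' : RAMState} {k l : ℕ} (h : σ.reg i ≠ 0)
      (hP : RAMExec P σ σ' k) (hL : RAMExec (.loop i P) σ' σ'' l) :
      RAMExec (.loop i P) σ σ'' (k + l + 1)
  | loop_false {i : ℕ} {P : RAMProgram} {σ : RAMState} (h : σ.reg i = 0) :
      RAMExec (.loop i P) σ σ 1

/-! ## Max-flow instances as inputs of the machine -/

namespace FlowNetwork

/-- The code of a capacity that is a natural number or `∞`: `0` for `∞`, and `a + 1` for the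
natural number `a`. -/
noncomputable def capCode (c : ℝ≥0∞) : ℕ := if c = ⊤ then 0 else ⌊c.toNNReal⌋₊ + 1

variable {N : Type u} (F : FlowNetwork N)

open Classical in
/-- The initial state of the machine for the max-flow problem on `F`, where `F` has natural or
infinite capacities and its `n` nodes are numbered by `0, …, n - 1`:
the registers `R_0, R_1, R_2` hold `n`, the source and the sink;
the memory cell `i < n` holds the code of the capacity of the node `i`;
the memory cell `n + n * i + j`, for `i, j < n`, holds `0` if there is no edge from `i` to `j`, and
one plus the code of its capacity if there is one;
all other registers and memory cells hold `0`. -/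
noncomputable def input {n : ℕ} (e : N ≃ Fin n) : RAMState where
  reg k := if k = 0 then n else if k = 1 then e F.source else if k = 2 then e F.sink else 0
  mem a :=
    if h : a < n then capCode (F.nodeCap (e.symm ⟨a, h⟩))
    else if h : a - n < n * n then
      if F.edge (e.symm (finProdFinEquiv.symm ⟨a - n, h⟩).1)
          (e.symm (finProdFinEquiv.symm ⟨a - n, h⟩).2) then
        capCode (F.edgeCap (e.symm (finProdFinEquiv.symm ⟨a - n, h⟩).1)
          (e.symm (finProdFinEquiv.symm ⟨a - n, h⟩).2)) + 1
      else 0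
    else 0

/-- The state `σ` of the machine presents a solution of the max-flow problem on `F`, with nodes
numbered by `0, …, n - 1`: there is a maximum flow `f` whose size is in the register `R_0` and
whose value on the pair `(i, j)` is in the memory cell `n + n * n + n * i + j`. -/
def IsOutput [Fintype N] {n : ℕ} (e : N ≃ Fin n) (σ : RAMState) : Prop :=
  ∃ f : N → N → ℝ≥0, F.IsMaxFlow f ∧ (σ.reg 0 : ℝ≥0) = F.size f ∧
    ∀ i j : Fin n, (σ.mem (n + n * n + n * i + j) : ℝ≥0) = f (e.symm i) (e.symm j)

end FlowNetwork

/-!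
Since every inner node of `G_flow` has capacity `1`, an integral flow is a system of vertex-disjoint
paths from the source to the sink. Such a system is encoded by the map `p` that sends each node to
its predecessor, and each node not on a path to itself; then `p` is injective except that all first
nodes of paths go to the source, and augmenting the system along `w₁, …, wₘ` amounts to replacing
`p wᵢ₊₁` by `p wᵢ`. If the search for an augmentation fails, the nodes it has reached bound a cut
whose size is the number of paths, so the paths are a maximum flow.

A system of `|D|` paths ends in all the nodes `R_v(w)` with `w ∈ pa(v)`. Inside the copy `R_v` of
the graph, the paths are then half-treks onto `pa(v)` with disjoint right-hand sides, and the nodes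
`L{y, v}` that they come from give their left-hand sides `Y_v`. Since a node `L{v, w}` carries at
most one path, `v ∈ Y_w` and `w ∈ Y_v` do not both hold.

A search takes `O(n²)` steps and succeeds at most `n` times, where `n ≤ 4 |V|²` is the number of
nodes of `G_flow`, hence the running time `O(n³) = O(|V|⁶)`.
-/

/-! ## Linkages and maximum flows -/

namespace FlowNetwork

variable {N : Type u} (F : FlowNetwork N)

/-- Infinite edge capacities, unit capacities of the inner nodes, and no edge into the source or
from the source to the sink: the networks for which a maximum flow is a maximum family of
vertex-disjoint paths. -/
structure IsUnitCapacity : Prop where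
  edgeCap : ∀ x y, F.edgeCap x y = ⊤
  nodeCap : ∀ x, x ≠ F.source → x ≠ F.sink → F.nodeCap x = 1
  source_ne_sink : F.source ≠ F.sink
  not_edge : ¬ F.edge F.source F.sink
  not_edge_source : ∀ x, ¬ F.edge x F.source

/-- A set `K` of nodes separates the source from the sink, where `X` is the source side. -/
structure IsCut (X K : Finset N) : Prop where
  source_mem : F.source ∈ X
  source_notMem : F.source ∉ K
  sink_notMem : F.sink ∉ X
  sink_notMem_separator : F.sink ∉ K
  closed : ∀ x ∈ X, ∀ z, F.edge x z → z ∈ X ∨ z ∈ K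

/-- The nodes that precede no node outside `H`, for a predecessor map `p`: the last nodes of the
paths along `p` once the edges into `H` are removed. -/
def ends (p : N → N) (H : Set N) : Set N := (p '' Hᶜ)ᶜ

/-- Vertex-disjoint paths from the source towards the sink (and cycles), given by the predecessor
`p a` of each node `a` outside the set `H` of holes, where `p a = a` if `a` is not used. The sink
is never used: the last inner nodes of the paths are the `ends`, which have an edge to the sink. -/
structure IsLinkage (p : N → N) (H : Set N) : Prop where
  source : p F.source = F.source
  sink : p F.sink = F.sink
  inj : ∀ a ∉ H, ∀ b ∉ H, p a = p b → p a ≠ F.source → a = b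
  step : ∀ a ∉ H, Relation.ReflGen F.edge (p a) a
  last : ∀ x ∈ ends p H, F.edge x F.sink

/-- The set `{y}`, or `∅` if `y` is the source, which has no predecessor to give up. -/
def hole (y : N) : Set N := {y} \ {F.source}

/-- A set of nodes that contains the source and that a search for an augmentation of the linkage
`p` does not leave. A node `a` is reached by the search if some path can give up its edge from
`p a` to `a`. -/
structure IsBarrier (p : N → N) (W : Set N) : Prop where
  source_mem : F.source ∈ W
  sink_notMem : F.sink ∉ W
  not_edge : ∀ a ∈ W, ¬ F.edge (p a) F.sink
  closed : ∀ a ∈ W, ∀ z, Relation.ReflGen F.edge (p a) z → z ∈ W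

open Classical in
/-- The flow along the paths and cycles of a linkage. -/
noncomputable def linkageFlow (p : N → N) (x y : N) : ℝ≥0 :=
  if p y = x ∧ x ≠ y ∨ y = F.sink ∧ x ∈ ends p ∅ then 1 else 0

variable {F} {p : N → N}

theorem mem_ends_empty {x : N} : x ∈ ends p ∅ ↔ ∀ a, p a ≠ x := by
  simp [ends]

@[simp]
theorem hole_source : F.hole F.source = ∅ := by
  simp [hole]

theorem notMem_hole {a y : N} : a ∉ F.hole y ↔ a ≠ y ∨ a = F.source := by
  simp only [hole, Set.mem_sdiff, Set.mem_singleton_iff]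
  tauto

theorem isLinkage_id : F.IsLinkage id ∅ where
  source := rfl
  sink := rfl
  inj _ _ _ _ h _ := h
  step _ _ := .refl
  last _ hx := absurd rfl (mem_ends_empty.1 hx _)

theorem ends_extend (h : F.IsLinkage p ∅) {y : N} (hy : p y ≠ F.source) :
    ends p (F.hole y) = insert (p y) (ends p ∅) := by
  ext x
  simp only [ends, Set.mem_compl_iff, Set.mem_image, Set.mem_insert_iff, Set.mem_empty_iff_false,
    not_false_eq_true, true_and, notMem_hole, not_exists, not_and]
  constructor
  · intro hx
    refine or_iff_not_imp_left.2 fun hxy a ha => hx a (.inl ?_) ha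
    rintro rfl
    exact hxy ha.symm
  · rintro (rfl | hx) a ha e
    · obtain rfl := h.inj a (by simp) y (by simp) e (e ▸ hy)
      exact hy (by simpa [h.source] using congrArg p (ha.resolve_left (by simp)))
    · exact hx a e

theorem IsLinkage.extend (h : F.IsLinkage p ∅) {y : N} (hy : p y ≠ F.source)
    (hyt : F.edge (p y) F.sink) : F.IsLinkage p (F.hole y) where
  source := h.source
  sink := h.sink
  inj a _ b _ := h.inj a (by simp) b (by simp)
  step a _ := h.step a (by simp)
  last x hx := by
    rw [ends_extend h hy] at hx
    rcases hx with rfl | hx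
    exacts [hyt, h.last x hx]

theorem ends_shift [DecidableEq N] {w y : N} (hwy : w ≠ y) (hys : y ≠ F.source) :
    ends (Function.update p y (p w)) (F.hole w) = ends p (F.hole y) := by
  ext x
  simp only [ends, Set.mem_compl_iff, Set.mem_image, notMem_hole, not_exists, not_and]
  constructor
  · rintro hx a ha e
    have hay : a ≠ y := by rintro rfl; exact hys (ha.resolve_left (by simp))
    by_cases haw : a = w
    · exact hx y (.inl hwy.symm) (by rw [Function.update_self, ← haw, e])
    · exact hx a (.inl haw) (by rw [Function.update_of_ne hay, e])
  · rintro hx a - e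
    by_cases hay : a = y
    · exact hx w (.inl hwy) (by rwa [hay, Function.update_self] at e)
    · exact hx a (.inl hay) (by rwa [Function.update_of_ne hay] at e)

theorem IsLinkage.shift [DecidableEq N] {w y : N} (h : F.IsLinkage p (F.hole y)) (hwy : w ≠ y)
    (hys : y ≠ F.source) (hyt : y ≠ F.sink) (hstep : Relation.ReflGen F.edge (p w) y) :
    F.IsLinkage (Function.update p y (p w)) (F.hole w) := by
  have ne_of_fresh {b : N} (hby : b ≠ y) (hbw : b ∉ F.hole w) (hb : p b ≠ F.source) :
      p w ≠ p b := by
    intro e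
    obtain rfl := h.inj w (notMem_hole.2 (.inl hwy)) b (notMem_hole.2 (.inl hby)) e (e ▸ hb)
    exact hb ((notMem_hole.1 hbw).resolve_left (by simp) ▸ h.source)
  refine ⟨?_, ?_, fun a ha b hb e hs => ?_, fun a _ => ?_, fun x hx => ?_⟩
  · rw [Function.update_of_ne hys.symm, h.source]
  · rw [Function.update_of_ne hyt.symm, h.sink]
  · rcases eq_or_ne a y with rfl | hay <;> rcases eq_or_ne b a with rfl | hba
    · rfl
    · rw [Function.update_self, Function.update_of_ne hba] at e
      rw [Function.update_self] at hs
      exact absurd e (ne_of_fresh hba hb (e ▸ hs))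
    · rfl
    · rw [Function.update_of_ne hay] at e hs
      rcases eq_or_ne b y with rfl | hby
      · rw [Function.update_self] at e
        exact absurd e.symm (ne_of_fresh hay ha hs)
      · rw [Function.update_of_ne hby] at e
        exact h.inj a (notMem_hole.2 (.inl hay)) b (notMem_hole.2 (.inl hby)) e hs
  · rcases eq_or_ne a y with rfl | hay
    · rwa [Function.update_self]
    · rw [Function.update_of_ne hay]
      exact h.step a (notMem_hole.2 (.inl hay))
  · rw [ends_shift hwy hys] at hx
    exact h.last x hx

theorem ncard_sdiff_image [Finite N] {s : N} {W : Set N} (hs : s ∈ W) (hps : p s = s)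
    (hpW : Set.MapsTo p W W) (hinj : Set.InjOn p {y ∈ W | p y ≠ s}) :
    (W \ p '' W).ncard = {y ∈ W | p y = s ∧ y ≠ s}.ncard := by
  have himage : p '' W = insert s (p '' {y ∈ W | p y ≠ s}) := by
    ext x
    constructor
    · rintro ⟨y, hy, rfl⟩
      by_cases h : p y = s
      exacts [.inl h, .inr ⟨y, ⟨hy, h⟩, rfl⟩]
    · rintro (rfl | ⟨y, hy, rfl⟩)
      exacts [⟨x, hs, hps⟩, ⟨y, hy.1, rfl⟩]
  have hfibre : {y ∈ W | p y = s} = insert s {y ∈ W | p y = s ∧ y ≠ s} := by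
    ext y
    by_cases h : y = s <;> simp +contextual [h, hs, hps]
  have himage_card : (p '' W).ncard = {y ∈ W | p y ≠ s}.ncard + 1 := by
    rw [himage, Set.ncard_insert_of_notMem, hinj.ncard_image]
    exact fun ⟨y, hy, e⟩ => hy.2 e
  have hfibre_card : {y ∈ W | p y = s}.ncard = {y ∈ W | p y = s ∧ y ≠ s}.ncard + 1 := by
    rw [hfibre, Set.ncard_insert_of_notMem fun h => h.2.2 rfl]
  have hsplit : {y ∈ W | p y = s}.ncard + {y ∈ W | p y ≠ s}.ncard = W.ncard :=
    Set.ncard_inter_add_ncard_sdiff_eq_ncard W {y | p y = s}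
  have := Set.ncard_sdiff_add_ncard_of_subset hpW.image_subset
  omega

theorem IsLinkage.ncard_ends [Finite N] (h : F.IsLinkage p ∅) :
    (ends p ∅).ncard = {y | p y = F.source ∧ y ≠ F.source}.ncard := by
  simpa [ends, Set.compl_eq_univ_sdiff] using
    ncard_sdiff_image (Set.mem_univ F.source) h.source (Set.mapsTo_univ p _)
      fun a ha b _ e => h.inj a (by simp) b (by simp) e ha.2

theorem IsLinkage.exists_isCut [Finite N] (h : F.IsLinkage p ∅) {W : Set N}
    (hW : F.IsBarrier p W) : ∃ X K : Finset N, F.IsCut X K ∧ K.card = (ends p ∅).ncard := by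
  have hpW : Set.MapsTo p W W := fun a ha => hW.closed a ha _ .refl
  have hs : F.source ∈ p '' W := ⟨_, hW.source_mem, h.source⟩
  refine ⟨(p '' W).toFinite.toFinset, (W \ p '' W).toFinite.toFinset, ?_, ?_⟩
  · constructor <;> simp only [Set.Finite.mem_toFinset]
    · exact hs
    · exact fun hmem => hmem.2 hs
    · exact fun ht => hW.sink_notMem (hpW.image_subset ht)
    · exact fun ht => hW.sink_notMem ht.1
    · rintro _ ⟨a, ha, rfl⟩ z hxz
      exact or_iff_not_imp_left.2 fun hz => ⟨hW.closed a ha z (.single hxz), hz⟩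
  · have hfirst : {y | p y = F.source ∧ y ≠ F.source} ⊆ W := fun y hy => by
      have hstep := h.step y (by simp)
      rw [hy.1] at hstep
      exact hW.closed _ hW.source_mem y (by rwa [h.source])
    rw [← Set.ncard_eq_toFinset_card, h.ncard_ends, ← Set.inter_eq_right.2 hfirst]
    exact ncard_sdiff_image hW.source_mem h.source hpW
      fun a ha b _ e => h.inj a (by simp) b (by simp) e ha.2

theorem linkageFlow_eq_ite {x y : N} {P : Prop} [Decidable P]
    (h : p y = x ∧ x ≠ y ∨ y = F.sink ∧ x ∈ ends p ∅ ↔ P) :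
    F.linkageFlow p x y = if P then 1 else 0 := by
  simp only [linkageFlow, h]

section Flow

variable [Fintype N]

open Classical in
theorem sum_linkageFlow_left {x : N} (hx : x ≠ F.sink) :
    ∑ y, F.linkageFlow p y x = if p x = x then 0 else 1 := by
  have (y : N) : F.linkageFlow p y x = if y = p x then (if p x = x then 0 else 1) else 0 := by
    rw [linkageFlow_eq_ite (P := y = p x ∧ p x ≠ x) (by grind), ite_and, ite_not]
  simp [this]

open Classical in
theorem IsLinkage.sum_linkageFlow_right (h : F.IsLinkage p ∅) {x : N} (hx : x ≠ F.source) :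
    ∑ y, F.linkageFlow p x y = if p x = x then 0 else 1 := by
  by_cases hend : x ∈ ends p ∅
  · have hout (y : N) : F.linkageFlow p x y = if y = F.sink then 1 else 0 :=
      linkageFlow_eq_ite ⟨fun hy => hy.elim (fun e => absurd e.1 (mem_ends_empty.1 hend y)) (·.1),
        fun e => .inr ⟨e, hend⟩⟩
    simp [hout, mem_ends_empty.1 hend x]
  · obtain ⟨a, ha⟩ : ∃ a, p a = x := by simpa [mem_ends_empty] using hend
    have hout (y : N) : F.linkageFlow p x y = if y = a then (if p x = x then 0 else 1) else 0 := by
      rw [linkageFlow_eq_ite (P := y = a ∧ p x ≠ x) ⟨?_, ?_⟩, ite_and, ite_not]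
      · rintro (⟨hy, hne⟩ | ⟨-, hy⟩)
        · obtain rfl := h.inj y (by simp) a (by simp) (hy.trans ha.symm) (hy ▸ hx)
          exact ⟨rfl, fun e => hne (h.inj x (by simp) y (by simp) (e.trans ha.symm) (by rwa [e]))⟩
        · exact absurd hy hend
      · rintro ⟨rfl, hne⟩
        exact .inl ⟨ha, fun e => hne (e ▸ ha)⟩
    simp [hout]

theorem IsLinkage.isFlow (hF : F.IsUnitCapacity) (h : F.IsLinkage p ∅) :
    F.IsFlow (F.linkageFlow p) := by
  classical
  refine ⟨fun x y hxy => if_neg ?_, fun x hs ht => ?_, fun x y _ => by simp [hF.edgeCap]⟩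
  · rintro (⟨rfl, hne⟩ | ⟨rfl, hx⟩)
    · exact hxy (((Relation.reflGen_iff ..).1 (h.step y (by simp))).resolve_left hne.symm)
    · exact hxy (h.last x hx)
  · rw [sum_linkageFlow_left ht, h.sum_linkageFlow_right hs, hF.nodeCap x hs ht]
    refine ⟨rfl, ?_⟩
    split_ifs <;> simp

theorem IsLinkage.size_linkageFlow (h : F.IsLinkage p ∅) :
    F.size (F.linkageFlow p) = (ends p ∅).ncard := by
  classical
  have hout (y : N) : F.linkageFlow p F.source y =
      if p y = F.source ∧ y ≠ F.source then 1 else 0 := by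
    refine linkageFlow_eq_ite ⟨?_, fun ⟨e, hne⟩ => .inl ⟨e, hne.symm⟩⟩
    rintro (⟨e, hne⟩ | ⟨-, hend⟩)
    · exact ⟨e, hne.symm⟩
    · exact absurd h.source (mem_ends_empty.1 hend _)
  simp only [size, hout, h.ncard_ends, Finset.sum_boole, Set.ncard_eq_toFinset_card',
    Set.toFinset_ofPred]

theorem IsFlow.size_add_sum_inflow {f : N → N → ℝ≥0} (hf : F.IsFlow f) (hF : F.IsUnitCapacity)
    {X : Finset N} (hs : F.source ∈ X) (ht : F.sink ∉ X) :
    F.size f + ∑ x ∈ X, ∑ y, f y x = ∑ x ∈ X, ∑ y, f x y := by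
  classical
  have hinflow : ∑ y, f y F.source = 0 :=
    Finset.sum_eq_zero fun y _ => hf.1 _ _ (hF.not_edge_source y)
  rw [← Finset.add_sum_erase X _ hs, ← Finset.add_sum_erase X (fun x => ∑ y, f x y) hs, hinflow,
    zero_add, size]
  refine congrArg _ (Finset.sum_congr rfl fun x hx => ?_)
  obtain ⟨hxs, hxX⟩ := Finset.mem_erase.1 hx
  exact (hf.2.1 x hxs (ne_of_mem_of_not_mem hxX ht)).1

theorem IsFlow.inflow_le_one {f : N → N → ℝ≥0} (hf : F.IsFlow f) (hF : F.IsUnitCapacity) {z : N}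
    (hs : z ≠ F.source) (ht : z ≠ F.sink) : ∑ x, f x z ≤ 1 := by
  obtain ⟨hconserved, hcap⟩ := hf.2.1 z hs ht
  rw [hconserved]
  exact_mod_cast hF.nodeCap z hs ht ▸ hcap

theorem IsCut.sum_outflow_le {X K : Finset N} (hc : F.IsCut X K) (hF : F.IsUnitCapacity)
    {f : N → N → ℝ≥0} (hf : F.IsFlow f) :
    ∑ x ∈ X, ∑ y, f x y ≤ K.card + ∑ x ∈ X, ∑ y ∈ X, f x y := by
  classical
  have hsupp : ∀ x ∈ X, ∑ y, f x y ≤ ∑ y ∈ K, f x y + ∑ y ∈ X, f x y := fun x hx =>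
    calc ∑ y, f x y = ∑ y ∈ K ∪ X, f x y :=
          (Finset.sum_subset (Finset.subset_univ _) fun z _ hz => hf.1 _ _ fun he =>
            hz (Finset.mem_union.2 (hc.closed x hx z he).symm)).symm
      _ ≤ _ := Finset.sum_union_inter (s₁ := K) (s₂ := X) (f := f x) ▸ le_self_add
  have hsep : ∑ x ∈ X, ∑ y ∈ K, f x y ≤ K.card :=
    calc ∑ x ∈ X, ∑ y ∈ K, f x y = ∑ y ∈ K, ∑ x ∈ X, f x y := Finset.sum_comm
      _ ≤ ∑ y ∈ K, ∑ x, f x y :=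
          Finset.sum_le_sum fun _ _ => Finset.sum_le_sum_of_subset (Finset.subset_univ _)
      _ ≤ K.card • 1 := Finset.sum_le_card_nsmul K _ 1 fun z hz => hf.inflow_le_one hF
          (ne_of_mem_of_not_mem hz hc.source_notMem)
          (ne_of_mem_of_not_mem hz hc.sink_notMem_separator)
      _ = K.card := by simp
  calc ∑ x ∈ X, ∑ y, f x y ≤ ∑ x ∈ X, (∑ y ∈ K, f x y + ∑ y ∈ X, f x y) := Finset.sum_le_sum hsupp
    _ ≤ K.card + ∑ x ∈ X, ∑ y ∈ X, f x y := by
        rw [Finset.sum_add_distrib]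
        exact add_le_add_left hsep _

theorem IsCut.size_le {X K : Finset N} (hc : F.IsCut X K) (hF : F.IsUnitCapacity) {f : N → N → ℝ≥0}
    (hf : F.IsFlow f) : F.size f ≤ K.card := by
  refine le_of_add_le_add_right (a := ∑ x ∈ X, ∑ y, f y x) ?_
  calc F.size f + ∑ x ∈ X, ∑ y, f y x = ∑ x ∈ X, ∑ y, f x y :=
        hf.size_add_sum_inflow hF hc.source_mem hc.sink_notMem
    _ ≤ K.card + ∑ x ∈ X, ∑ y ∈ X, f x y := hc.sum_outflow_le hF hf
    _ = K.card + ∑ x ∈ X, ∑ y ∈ X, f y x := by rw [Finset.sum_comm]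
    _ ≤ K.card + ∑ x ∈ X, ∑ y, f y x := by
        gcongr
        exact Finset.subset_univ _

theorem IsLinkage.isMaxFlow (h : F.IsLinkage p ∅) (hF : F.IsUnitCapacity) {W : Set N}
    (hW : F.IsBarrier p W) : F.IsMaxFlow (F.linkageFlow p) := by
  obtain ⟨X, K, hcut, hK⟩ := h.exists_isCut hW
  refine ⟨h.isFlow hF, fun f hf => ?_⟩
  rw [h.size_linkageFlow, ← hK]
  exact hcut.size_le hF hf

theorem IsLinkage.exists_isMaxFlow_size_lt_iff (h : F.IsLinkage p ∅) (hF : F.IsUnitCapacity)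
    {W : Set N} (hW : F.IsBarrier p W) {m : ℕ} :
    (∃ f, F.IsMaxFlow f ∧ F.size f < m) ↔ (ends p ∅).ncard < m := by
  have hmax := h.isMaxFlow hF hW
  rw [← Nat.cast_lt (α := ℝ≥0), ← h.size_linkageFlow]
  exact ⟨fun ⟨f, hf, hlt⟩ => (hf.2 _ hmax.1).trans_lt hlt, fun hlt => ⟨_, hmax, hlt⟩⟩

end Flow

namespace IsLinkage

theorem eq_of_iterate_eq (h : F.IsLinkage p ∅) {x y : N} (hx : x ∈ ends p ∅) (hy : y ∈ ends p ∅)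
    {i j : ℕ} (hij : p^[i] x = p^[j] y) (hs : p^[i] x ≠ F.source) : i = j ∧ x = y := by
  rw [mem_ends_empty] at hx hy
  induction i generalizing j with
  | zero =>
    cases j with
    | zero => exact ⟨rfl, hij⟩
    | succ j => exact absurd (hij.trans (Function.iterate_succ_apply' ..)).symm (hx _)
  | succ i ih =>
    cases j with
    | zero => exact absurd ((Function.iterate_succ_apply' ..).symm.trans hij) (hy _)
    | succ j =>
      simp only [Function.iterate_succ_apply'] at hij hs
      have hne : p^[i] x ≠ F.source := fun e => hs (by rw [e, h.source])
      exact (ih (h.inj _ (by simp) _ (by simp) hij hs) hne).imp_left (congrArg _)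

theorem exists_iterate_eq_source [Finite N] (h : F.IsLinkage p ∅) {x : N} (hx : x ∈ ends p ∅) :
    ∃ i, p^[i] x = F.source := by
  by_contra! hs
  exact not_injective_infinite_finite (fun i => p^[i] x) fun i j hij =>
    (h.eq_of_iterate_eq hx hx hij (hs i)).1

theorem edge_iterate (h : F.IsLinkage p ∅) {x : N} (hx : x ∈ ends p ∅) {i : ℕ}
    (hs : p^[i] x ≠ F.source) : F.edge (p^[i + 1] x) (p^[i] x) := by
  have hstep := h.step (p^[i] x) (by simp)
  rw [← Function.iterate_succ_apply' p] at hstep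
  refine ((Relation.reflGen_iff ..).1 hstep).resolve_left fun e => ?_
  exact i.succ_ne_self (h.eq_of_iterate_eq hx hx e hs).1.symm

end IsLinkage

end FlowNetwork

/-! ## Linkages of `G_flow` and half-trek systems -/

namespace MixedGraph

variable {V : Type u} (G : MixedGraph V)

theorem isUnitCapacity_flowNetwork : G.flowNetwork.IsUnitCapacity where
  edgeCap _ _ := rfl
  nodeCap x hs ht := by
    cases x with
    | source => exact absurd rfl hs
    | sink => exact absurd rfl ht
    | left => rfl
    | right => rfl
  source_ne_sink h := by cases h
  not_edge h := by cases h
  not_edge_source x h := by cases h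

theorem numDirected_eq_card_sigma : G.numDirected = Nat.card (Σ v, G.pa v) :=
  Nat.card_congr
    { toFun := fun q => ⟨q.1.2, q.1.1, q.2⟩
      invFun := fun a => ⟨(a.2, a.1), a.2.2⟩ }

theorem numDirected_eq_sum [Fintype V] : G.numDirected = ∑ v, (G.pa v).ncard := by
  rw [numDirected_eq_card_sigma, Nat.card_sigma]
  rfl

theorem two_mul_numReciprocal_le [Finite V] : 2 * G.numReciprocal ≤ G.numDirected := by
  classical
  have := Fintype.ofFinite V
  rw [numReciprocal, numDirected, Set.ncard_eq_toFinset_card', Set.ncard_eq_toFinset_card',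
    mul_comm, ← mul_one (Finset.card (Set.toFinset {p : V × V | _}))]
  refine Finset.card_mul_le_card_mul (fun z q => s(q.1, q.2) = z) (fun z hz => ?_) fun q _ => ?_
  · obtain ⟨v, w, hne, hvw, hwv, rfl⟩ := Set.mem_toFinset.1 hz
    rw [← Finset.card_pair (a := (v, w)) (b := (w, v)) (by simp [hne])]
    refine Finset.card_le_card ?_
    simp [Finset.insert_subset_iff, Finset.mem_bipartiteAbove, hvw, hwv]
  · exact Finset.card_le_one.2 fun z hz z' hz' =>
      ((Finset.mem_bipartiteBelow _).1 hz).2.symm.trans ((Finset.mem_bipartiteBelow _).1 hz').2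

theorem card_flowNode_le [Fintype V] [Nonempty V] :
    Fintype.card G.FlowNode ≤ 4 * Fintype.card V ^ 2 := by
  classical
  let code : G.FlowNode → Bool ⊕ Sym2 V ⊕ V × V
    | .source => .inl true
    | .sink => .inl false
    | .left p => .inr (.inl p.1)
    | .right v w => .inr (.inr (v, w))
  have hcode : Function.Injective code := by
    intro x y h
    have hval (p q : G.NonSiblingPair) : p.1 = q.1 → p = q := Subtype.ext
    cases x <;> cases y <;> grind
  have hcard := Fintype.card_le_of_injective code hcode
  have hsym : Fintype.card (Sym2 V) ≤ Fintype.card V * Fintype.card V := by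
    rw [← Fintype.card_prod]
    exact Fintype.card_le_of_surjective (fun q : V × V => s(q.1, q.2)) Sym2.mk_surjective
  have hpos : 0 < Fintype.card V := Fintype.card_pos
  simp only [Fintype.card_sum, Fintype.card_bool, Fintype.card_prod] at hcard
  nlinarith

variable {G}

theorem NonSiblingPair.notMem_of_eq {q : G.NonSiblingPair} {v y : V} (h : q.1 = s(v, y)) :
    y ∉ ({v} ∪ G.sib v : Set V) := by
  obtain ⟨a, b, hne, hb, hab⟩ := q.2
  rcases Sym2.eq_iff.1 (hab.symm.trans h) with ⟨rfl, rfl⟩ | ⟨rfl, rfl⟩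
  · exact not_or_intro hne.symm fun hy => hb (G.bidir_symm _ _ hy)
  · exact not_or_intro hne hb

theorem exists_nonSiblingPair {v y : V} (h : y ∉ ({v} ∪ G.sib v : Set V)) :
    ∃ q : G.NonSiblingPair, q.1 = s(v, y) :=
  ⟨⟨_, v, y, fun e => h (.inl e.symm), fun e => h (.inr (G.bidir_symm _ _ e)), rfl⟩, rfl⟩

namespace Trek

/-- The nodes of `G_flow` between the source and the sink on the path that encodes a half-trek
`π` to a parent of `v`. -/
def trace (v : V) (π : G.Trek) : Set G.FlowNode :=
  {x | (∃ q : G.NonSiblingPair, q.1 = s(v, π.source) ∧ x = .left q) ∨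
    ∃ z ∈ π.right, x = .right v z}

theorem source_notMem_trace {v : V} (π : G.Trek) : .source ∉ π.trace v := by
  rintro (⟨q, -, ⟨⟩⟩ | ⟨z, -, ⟨⟩⟩)

theorem IsHalfTrek.left_eq {π : G.Trek} (h : π.IsHalfTrek) : π.left = {π.source} := by
  obtain ⟨a, ha⟩ := Set.ncard_eq_one.1 h
  have hmem : π.source ∈ π.left := List.getLast_mem _
  rw [ha] at hmem ⊢
  rw [Set.mem_singleton_iff.1 hmem]

theorem IsHalfTrek.head_eq_source {π : G.Trek} (h : π.IsHalfTrek) :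
    π.leftList.head π.left_ne_nil = π.source := by
  have hmem : π.leftList.head π.left_ne_nil ∈ π.left := List.head_mem _
  rwa [h.left_eq] at hmem

end Trek

/-- Half-treks to all parents of all nodes, such that the paths in `G_flow` that encode them exist
and are vertex-disjoint. -/
structure IsHalfTrekPacking (π : (Σ v, G.pa v) → G.Trek) : Prop where
  isHalfTrek : ∀ a, (π a).IsHalfTrek
  target_eq : ∀ a, (π a).target = a.2
  source_notMem : ∀ a, (π a).source ∉ ({a.1} ∪ G.sib a.1 : Set V)
  disjoint : Pairwise (Function.onFun Disjoint fun a => (π a).trace a.1)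

namespace IsHalfTrekPacking

variable {π : (Σ v, G.pa v) → G.Trek}

theorem eq_of_mem_trace (h : G.IsHalfTrekPacking π) {a b : Σ v, G.pa v} {x : G.FlowNode}
    (ha : x ∈ (π a).trace a.1) (hb : x ∈ (π b).trace b.1) : a = b :=
  h.disjoint.eq (Set.not_disjoint_iff.2 ⟨x, ha, hb⟩)

theorem eq_of_pair_eq (h : G.IsHalfTrekPacking π) {a b : Σ v, G.pa v}
    (hab : s(a.1, (π a).source) = s(b.1, (π b).source)) : a = b := by
  obtain ⟨q, hq⟩ := exists_nonSiblingPair (h.source_notMem a)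
  exact h.eq_of_mem_trace (x := .left q) (.inl ⟨q, hq, rfl⟩) (.inl ⟨q, hq.trans hab, rfl⟩)

theorem eq_of_source_eq (h : G.IsHalfTrekPacking π) {v : V} {w w' : G.pa v}
    (hw : (π ⟨v, w⟩).source = (π ⟨v, w'⟩).source) : w = w' :=
  eq_of_heq (Sigma.mk.inj (h.eq_of_pair_eq (congrArg (fun y => s(v, y)) hw))).2

theorem halfTrekCriterion (h : G.IsHalfTrekPacking π) (v : V) :
    G.HalfTrekCriterion v (Set.range fun w => (π ⟨v, w⟩).source) := by
  refine ⟨?_, ?_, Set.range fun w => π ⟨v, w⟩, ⟨⟨?_, ?_, ?_⟩, ?_, ?_, ?_⟩, ?_, ?_⟩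
  · rw [← Set.image_univ, Set.ncard_image_of_injective _ fun _ _ => h.eq_of_source_eq,
      Set.ncard_univ]
    rfl
  · rw [← Set.disjoint_iff_inter_eq_empty, Set.disjoint_left]
    rintro _ ⟨w, rfl⟩
    exact h.source_notMem _
  · rintro _ ⟨w, rfl⟩
    exact ⟨w, rfl⟩
  · rintro _ ⟨w, rfl⟩ _ ⟨w', rfl⟩ hw
    rw [h.eq_of_source_eq hw]
  · rintro _ ⟨w, rfl⟩
    exact ⟨_, ⟨w, rfl⟩, rfl⟩
  · rintro _ ⟨w, rfl⟩
    exact h.target_eq ⟨v, w⟩ ▸ w.2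
  · rintro _ ⟨w, rfl⟩ _ ⟨w', rfl⟩ hw
    have hw : w = w' := Subtype.ext ((h.target_eq _).symm.trans (hw.trans (h.target_eq _)))
    rw [hw]
  · exact fun w hw => ⟨_, ⟨⟨w, hw⟩, rfl⟩, h.target_eq _⟩
  · rintro _ ⟨w, rfl⟩
    exact h.isHalfTrek _
  · rintro _ ⟨w, rfl⟩ _ ⟨w', rfl⟩ hne
    have hww : w ≠ w' := fun e => hne (by rw [e])
    rw [(h.isHalfTrek _).left_eq, (h.isHalfTrek _).left_eq, Set.disjoint_singleton]
    refine ⟨fun e => hww (h.eq_of_source_eq e), Set.disjoint_left.2 fun z hz hz' => hww ?_⟩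
    exact eq_of_heq (Sigma.mk.inj (h.eq_of_mem_trace (x := .right v z) (a := ⟨v, w⟩)
      (b := ⟨v, w'⟩) (.inr ⟨z, hz, rfl⟩) (.inr ⟨z, hz', rfl⟩))).2

theorem not_htcInfiniteToOne (h : G.IsHalfTrekPacking π) : ¬ G.HTCInfiniteToOne := by
  intro hG
  rcases hG fun v => Set.range fun w => (π ⟨v, w⟩).source with ⟨v, hv⟩ | ⟨v, v', ⟨w, hw⟩, w', hw'⟩
  · exact hv (h.halfTrekCriterion v)
  · obtain ⟨rfl, -⟩ := Sigma.mk.inj (h.eq_of_pair_eq (a := ⟨v', w⟩) (b := ⟨v, w'⟩)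
      (by simp only [hw, hw', Sym2.eq_swap]))
    exact h.source_notMem _ (.inl hw)

end IsHalfTrekPacking

theorem exists_isHalfTrekPacking (hG : ¬ G.HTCInfiniteToOne) :
    ∃ π : (Σ v, G.pa v) → G.Trek, G.IsHalfTrekPacking π := by
  simp only [HTCInfiniteToOne, not_forall, not_or, not_exists, not_not, not_and] at hG
  obtain ⟨Y, hY, hanti⟩ := hG
  choose _ hdisj T hT hhalf hsided using hY
  choose π hπ using fun a : Σ v, G.pa v => (hT a.1).2.surjOn a.2.2
  have hsource (a) : (π a).source ∈ Y a.1 := (hT a.1).1.mapsTo (hπ a).1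
  refine ⟨π, fun a => hhalf _ _ (hπ a).1, fun a => (hπ a).2,
    fun a => Set.disjoint_left.1 (Set.disjoint_iff_inter_eq_empty.2 (hdisj a.1)) (hsource a),
    fun a b hab => Set.disjoint_left.2 ?_⟩
  obtain ⟨v, w⟩ := a
  obtain ⟨v', w'⟩ := b
  have hne (h : v = v') : π ⟨v, w⟩ ≠ π ⟨v', w'⟩ := by
    subst h
    refine fun e => hab ?_
    exact congrArg (Sigma.mk v)
      (Subtype.ext ((hπ ⟨v, w⟩).2.symm.trans ((congrArg _ e).trans (hπ ⟨v, w'⟩).2)))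
  rintro _ (⟨q, hq, rfl⟩ | ⟨z, hz, rfl⟩) (⟨q', hq', hx⟩ | ⟨z', hz', hx⟩) <;> cases hx
  · rcases Sym2.eq_iff.1 (hq.symm.trans hq') with ⟨rfl, hss⟩ | ⟨hv, hv'⟩
    · exact hne rfl ((hT _).1.injOn (hπ ⟨v, w⟩).1 (hπ ⟨v, w'⟩).1 hss)
    · have hvY := hsource ⟨v', w'⟩
      have hvY' := hsource ⟨v, w⟩
      rw [← hv] at hvY
      rw [hv'] at hvY'
      exact hanti v v' hvY hvY'
  · exact Set.disjoint_left.1 (hsided v _ (hπ ⟨v, w⟩).1 _ (hπ ⟨v, w'⟩).1 (hne rfl)).2 hz hz'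

theorem right_getLast_mem_of_isCut {X K : Finset G.FlowNode} (hc : G.flowNetwork.IsCut X K)
    {v : V} {l : List V} (hl : l ≠ []) (hch : l.IsChain G.dir)
    (hX : .right v (l.head hl) ∈ X) (hK : ∀ z ∈ l, .right v z ∉ K) :
    .right v (l.getLast hl) ∈ X := by
  induction hch with
  | nil => exact absurd rfl hl
  | singleton => exact hX
  | cons_cons hab _ ih =>
    exact ih (by simp)
      ((hc.closed _ hX _ (.right_right v _ _ hab)).resolve_right (hK _ (by simp)))
      fun z hz => hK z (List.mem_cons_of_mem _ hz)

theorem Trek.exists_mem_trace_of_isCut {X K : Finset G.FlowNode} (hc : G.flowNetwork.IsCut X K)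
    {π : G.Trek} (hπ : π.IsHalfTrek) {v : V} (ht : π.target ∈ G.pa v)
    (hs : π.source ∉ ({v} ∪ G.sib v : Set V)) : ∃ x ∈ K, x ∈ π.trace v := by
  by_contra! hK
  obtain ⟨q, hq⟩ := exists_nonSiblingPair hs
  have hleft : .left q ∈ X := (hc.closed _ hc.source_mem _ (FlowEdge.source_left q)).resolve_right
    fun h => hK _ h (.inl ⟨q, hq, rfl⟩)
  have hright : ∀ z ∈ π.rightList, .right v z ∉ K := fun z hz h => hK _ h (.inr ⟨z, hz, rfl⟩)
  have hhead : .right v (π.rightList.head π.right_ne_nil) ∈ X := by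
    refine (hc.closed _ hleft _ ?_).resolve_right (hright _ (List.head_mem _))
    have hjoin := π.join
    rw [hπ.head_eq_source] at hjoin
    rcases hjoin with hjoin | hjoin
    · exact .left_right q v _ (by rw [hq, ← hjoin])
    · exact .left_right_sib q v _ _ hq hjoin
  have hlast := right_getLast_mem_of_isCut hc π.right_ne_nil π.right_chain hhead hright
  exact (hc.closed _ hlast _ (FlowEdge.right_sink v _ ht)).elim hc.sink_notMem
    hc.sink_notMem_separator

theorem IsHalfTrekPacking.numDirected_le_card {π : (Σ v, G.pa v) → G.Trek}
    (h : G.IsHalfTrekPacking π) {X K : Finset G.FlowNode} (hc : G.flowNetwork.IsCut X K) :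
    G.numDirected ≤ K.card := by
  choose x hxK hx using fun a => Trek.exists_mem_trace_of_isCut hc (h.isHalfTrek a)
    (h.target_eq a ▸ a.2.2) (h.source_notMem a)
  rw [numDirected_eq_card_sigma, ← Nat.card_eq_finsetCard K]
  refine Nat.card_le_card_of_injective (fun a => (⟨x a, hxK a⟩ : K)) fun a b hab => ?_
  have hxab : x a = x b := congrArg Subtype.val hab
  exact h.eq_of_mem_trace (hx a) (hxab ▸ hx b)

theorem exists_halfTrek_of_left_mem {O : Set G.FlowNode} {q : G.NonSiblingPair} {v y : V}
    (hq : q.1 = s(v, y)) (hqO : .left q ∈ O) {l : List V} (hl : l ≠ []) (hch : l.IsChain G.dir)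
    (hlO : ∀ z ∈ l, .right v z ∈ O) (hjoin : y = l.head hl ∨ G.bidir y (l.head hl)) :
    ∃ π : G.Trek, π.IsHalfTrek ∧ π.target = l.getLast hl ∧
      π.source ∉ ({v} ∪ G.sib v : Set V) ∧ π.trace v ⊆ O := by
  refine ⟨⟨[y], l, by simp, hl, by simp, hch, hjoin⟩, ?_, rfl, NonSiblingPair.notMem_of_eq hq, ?_⟩
  · exact Set.ncard_eq_one.2 ⟨y, by simp [Trek.left]⟩
  · rintro _ (⟨q', hq', rfl⟩ | ⟨z, hz, rfl⟩)
    · rwa [Subtype.ext (hq'.trans hq.symm)]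
    · exact hlO z hz

theorem exists_halfTrek_of_iterate_eq_source {p : G.FlowNode → G.FlowNode} {O : Set G.FlowNode}
    (hpO : Set.MapsTo p O O) (hedge : ∀ x ∈ O, x ≠ .source → G.FlowEdge (p x) x) {v : V} {k : ℕ}
    {l : List V} (hl : l ≠ []) (hch : l.IsChain G.dir) (hlO : ∀ z ∈ l, .right v z ∈ O)
    (hk : p^[k] (.right v (l.head hl)) = .source) :
    ∃ π : G.Trek, π.IsHalfTrek ∧ π.target = l.getLast hl ∧
      π.source ∉ ({v} ∪ G.sib v : Set V) ∧ π.trace v ⊆ O := by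
  induction k generalizing l with
  | zero => cases hk
  | succ k ih =>
    have hhead : .right v (l.head hl) ∈ O := hlO _ (List.head_mem hl)
    have hstep := hedge _ hhead (by rintro ⟨⟩)
    rw [Function.iterate_succ_apply] at hk
    generalize hx : p (.right v (l.head hl)) = x at hstep hk
    have hxO : x ∈ O := hx ▸ hpO hhead
    cases hstep with
    | left_right q v u hq => exact exists_halfTrek_of_left_mem hq hxO hl hch hlO (.inl rfl)
    | left_right_sib q v u x hq hb => exact exists_halfTrek_of_left_mem hq hxO hl hch hlO (.inr hb)
    | right_right v u _ hd =>
      rw [← List.getLast_cons hl]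
      refine ih (l := u :: l) (by simp) ?_ (List.forall_mem_cons.2 ⟨hxO, hlO⟩) hk
      exact hch.cons_of_ne_nil hl hd

theorem flowNode_right_injective :
    Function.Injective fun a : Σ v, G.pa v => (.right a.1 a.2 : G.FlowNode) := by
  rintro ⟨v, w⟩ ⟨v', w'⟩ h
  obtain ⟨rfl, hw⟩ := FlowNode.right.inj h
  exact congrArg (Sigma.mk v) (Subtype.ext hw)

theorem ends_eq_range_of_numDirected_le [Finite V] {p : G.FlowNode → G.FlowNode}
    (h : G.flowNetwork.IsLinkage p ∅) (hsize : G.numDirected ≤ (FlowNetwork.ends p ∅).ncard) :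
    FlowNetwork.ends p ∅ = Set.range fun a : Σ v, G.pa v => .right a.1 a.2 := by
  refine Set.eq_of_subset_of_ncard_le (fun x hx => ?_) ?_
  · have hlast : G.FlowEdge x .sink := h.last x hx
    cases hlast with
    | right_sink v w hw => exact ⟨⟨v, w, hw⟩, rfl⟩
  · rw [← Set.image_univ]
    exact (Set.ncard_image_le).trans
      (by rwa [Set.ncard_univ, ← numDirected_eq_card_sigma])

theorem exists_isHalfTrekPacking_of_isLinkage [Finite V] {p : G.FlowNode → G.FlowNode}
    (h : G.flowNetwork.IsLinkage p ∅) (hsize : G.numDirected ≤ (FlowNetwork.ends p ∅).ncard) :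
    ∃ π : (Σ v, G.pa v) → G.Trek, G.IsHalfTrekPacking π := by
  let orbit (a : Σ v, G.pa v) : Set G.FlowNode := Set.range fun i => p^[i] (.right a.1 a.2)
  have hend (a : Σ v, G.pa v) : .right a.1 a.2 ∈ FlowNetwork.ends p ∅ :=
    ends_eq_range_of_numDirected_le h hsize ▸ ⟨a, rfl⟩
  have hπ (a : Σ v, G.pa v) : ∃ π : G.Trek, π.IsHalfTrek ∧ π.target = a.2 ∧
      π.source ∉ ({a.1} ∪ G.sib a.1 : Set V) ∧ π.trace a.1 ⊆ orbit a := by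
    obtain ⟨k, hk⟩ := h.exists_iterate_eq_source (hend a)
    refine exists_halfTrek_of_iterate_eq_source (l := [a.2.1]) (p := p) ?_ ?_ (by simp) (by simp)
      ?_ hk
    · rintro _ ⟨i, rfl⟩
      exact ⟨i + 1, Function.iterate_succ_apply' ..⟩
    · rintro _ ⟨i, rfl⟩ hs
      exact Function.iterate_succ_apply' p i _ ▸ h.edge_iterate (hend a) hs
    · exact List.forall_mem_singleton.2 ⟨0, rfl⟩
  choose π hhalf htarget hsource htrace using hπ
  refine ⟨π, hhalf, htarget, hsource, fun a b hab => Set.disjoint_left.2 fun x ha hb => hab ?_⟩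
  obtain ⟨i, hi⟩ := htrace a ha
  obtain ⟨j, hj⟩ := htrace b hb
  have hx : x ≠ .source := ne_of_mem_of_not_mem ha (π a).source_notMem_trace
  exact flowNode_right_injective
    (h.eq_of_iterate_eq (hend a) (hend b) (hi.trans hj.symm) (by rwa [← hi] at hx)).2

theorem htcInfiniteToOne_iff_ncard_ends_lt [Finite V] {p : G.FlowNode → G.FlowNode}
    (h : G.flowNetwork.IsLinkage p ∅) {W : Set G.FlowNode} (hW : G.flowNetwork.IsBarrier p W) :
    G.HTCInfiniteToOne ↔ (FlowNetwork.ends p ∅).ncard < G.numDirected := by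
  rw [← not_iff_not, not_lt]
  constructor
  · intro hG
    obtain ⟨π, hπ⟩ := exists_isHalfTrekPacking hG
    obtain ⟨X, K, hcut, hK⟩ := h.exists_isCut hW
    exact hK ▸ hπ.numDirected_le_card hcut
  · intro hsize
    obtain ⟨π, hπ⟩ := exists_isHalfTrekPacking_of_isLinkage h hsize
    exact hπ.not_htcInfiniteToOne

end MixedGraph

/-! ## A max-flow program -/

namespace RAMState

variable {σ : RAMState} {i j x y : ℕ}

@[simp]
theorem reg_setReg : (σ.setReg i x).reg j = if j = i then x else σ.reg j :=
  Function.update_apply ..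

@[simp]
theorem mem_setReg : (σ.setReg i x).mem = σ.mem := rfl

@[simp]
theorem reg_setMem : (σ.setMem i x).reg = σ.reg := rfl

@[simp]
theorem setReg_setMem : (σ.setReg i x).setMem j y = (σ.setMem j y).setReg i x := rfl

end RAMState

namespace RAMProgram

/-- The weakest precondition: from `σ`, the program `P` halts in a state and after a number of steps
that satisfy `Q`. It is computed along the structure of `P`, except that loops refer to their
execution; loop-free programs are thus verified by unfolding. -/
def wp : RAMProgram → (RAMState → ℕ → Prop) → RAMState → Prop
  | skip, Q, σ => Q σ 1
  | const i c, Q, σ => Q (σ.setReg i c) 1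
  | add i j k, Q, σ => Q (σ.setReg i (σ.reg j + σ.reg k)) 1
  | sub i j k, Q, σ => Q (σ.setReg i (σ.reg j - σ.reg k)) 1
  | load i j, Q, σ => Q (σ.setReg i (σ.mem (σ.reg j))) 1
  | store i j, Q, σ => Q (σ.setMem (σ.reg i) (σ.reg j)) 1
  | seq P R, Q, σ => wp P (fun σ' k => wp R (fun σ'' l => Q σ'' (k + l)) σ') σ
  | ite i P R, Q, σ =>
      if σ.reg i = 0 then wp R (fun σ' k => Q σ' (k + 1)) σ else wp P (fun σ' k => Q σ' (k + 1)) σ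
  | loop i P, Q, σ => ∃ σ' k, RAMExec (loop i P) σ σ' k ∧ Q σ' k

/-- Sequential composition of a list of programs. -/
def block : List RAMProgram → RAMProgram
  | [] => skip
  | [P] => P
  | P :: l => seq P (block l)

variable {P : RAMProgram} {Q Q' : RAMState → ℕ → Prop} {σ : RAMState}

theorem wp_mono (h : wp P Q σ) (hQ : ∀ σ' k, Q σ' k → Q' σ' k) : wp P Q' σ := by
  induction P generalizing Q Q' σ with
  | seq P R ihP ihR => exact ihP h fun _ _ h' => ihR h' fun _ _ => hQ _ _
  | ite i P R ihP ihR =>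
    unfold wp at h ⊢
    split_ifs at h ⊢
    exacts [ihR h fun _ _ => hQ _ _, ihP h fun _ _ => hQ _ _]
  | loop i P =>
    obtain ⟨σ', k, hex, h⟩ := h
    exact ⟨σ', k, hex, hQ _ _ h⟩
  | _ => exact hQ _ _ h

theorem exists_exec_of_wp (h : wp P Q σ) : ∃ σ' k, RAMExec P σ σ' k ∧ Q σ' k := by
  induction P generalizing Q σ with
  | skip => exact ⟨_, _, .skip _, h⟩
  | const => exact ⟨_, _, .const .., h⟩
  | add => exact ⟨_, _, .add .., h⟩
  | sub => exact ⟨_, _, .sub .., h⟩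
  | load => exact ⟨_, _, .load .., h⟩
  | store => exact ⟨_, _, .store .., h⟩
  | seq P R ihP ihR =>
    obtain ⟨_, _, hP, h⟩ := ihP h
    obtain ⟨_, _, hR, h⟩ := ihR h
    exact ⟨_, _, .seq hP hR, h⟩
  | ite i P R ihP ihR =>
    unfold wp at h
    split_ifs at h with hi
    · obtain ⟨_, _, hR, h⟩ := ihR h
      exact ⟨_, _, .ite_false hi hR, h⟩
    · obtain ⟨_, _, hP, h⟩ := ihP h
      exact ⟨_, _, .ite_true hi hP, h⟩
  | loop i P => exact h

theorem wp_loop {i c : ℕ} (I : ℕ → RAMState → Prop)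
    (hP : ∀ v σ, I v σ → σ.reg i ≠ 0 → wp P (fun σ' k => k ≤ c ∧ ∃ v' < v, I v' σ') σ)
    (v : ℕ) (h : I v σ) :
    wp (.loop i P) (fun σ' k => k ≤ (c + 1) * v + 1 ∧ σ'.reg i = 0 ∧ ∃ v', I v' σ') σ := by
  induction v using Nat.strong_induction_on generalizing σ with
  | _ v ih =>
    by_cases hi : σ.reg i = 0
    · exact ⟨_, _, .loop_false hi, by omega, hi, v, h⟩
    · obtain ⟨σ', k, hexec, hk, v', hv', h'⟩ := exists_exec_of_wp (hP v σ h hi)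
      obtain ⟨σ'', l, hloop, hl, hQ⟩ := ih v' hv' h'
      have hcost : (c + 1) * (v' + 1) ≤ (c + 1) * v := Nat.mul_le_mul_left _ hv'
      exact ⟨_, _, .loop_true hi hexec hloop, by linarith, hQ⟩

theorem wp_countdown {i c : ℕ} (I : ℕ → RAMState → Prop) (hI : ∀ v σ, I v σ → σ.reg i = v) {v : ℕ}
    (hP : ∀ u < v, ∀ σ, I (u + 1) σ → wp P (fun σ' k => k ≤ c ∧ I u σ') σ) (h : I v σ) :
    wp (.loop i P) (fun σ' k => k ≤ (c + 1) * v + 1 ∧ I 0 σ') σ := by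
  refine wp_mono (wp_loop (fun u σ => u ≤ v ∧ I u σ) (c := c) ?_ v ⟨le_rfl, h⟩) ?_
  · rintro u σ ⟨hu, h⟩ hi
    obtain ⟨u, rfl⟩ := Nat.exists_eq_succ_of_ne_zero (hI u σ h ▸ hi)
    exact wp_mono (hP u hu σ h) fun σ' k ⟨hk, h'⟩ => ⟨hk, u, u.lt_succ_self, by omega, h'⟩
  · rintro σ' k ⟨hk, hi, u, -, h'⟩
    exact ⟨hk, (hI u σ' h').symm.trans hi ▸ h'⟩

end RAMProgram

local notation "rN" => (0 : ℕ)
local notation "rSource" => (1 : ℕ)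
local notation "rSink" => (2 : ℕ)
local notation "rZero" => (3 : ℕ)
local notation "rOne" => (4 : ℕ)
local notation "rSquare" => (5 : ℕ)
local notation "rLink" => (6 : ℕ)
local notation "rQueue" => (7 : ℕ)
local notation "rNode" => (10 : ℕ)
local notation "rCount" => (11 : ℕ)
local notation "rRow" => (12 : ℕ)
local notation "rTail" => (13 : ℕ)
local notation "rHead" => (14 : ℕ)
local notation "rPending" => (15 : ℕ)
local notation "rFound" => (16 : ℕ)
local notation "rSize" => (17 : ℕ)
local notation "rA" => (18 : ℕ)
local notation "rB" => (19 : ℕ)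

/-- The memory cells of the max-flow program on a network with node set `N`: the predecessor map,
the adjacency matrix, the output, the links of the search tree (`0` for a node that has not been
reached, and otherwise one plus the queue position of its parent), and the search queue. -/
inductive MemCell (N : Type*)
  | pred (x : N)
  | adj (x y : N)
  | out (x y : N)
  | link (x : N)
  | queue (k : ℕ)

namespace MemCell

variable {N : Type*} {n : ℕ} {e : N ≃ Fin n}

/-- The address of a memory cell, for the numbering `e` of the nodes. -/
def addr (e : N ≃ Fin n) : MemCell N → ℕ
  | pred x => e x
  | adj x y => n + finProdFinEquiv (e x, e y)
  | out x y => n + n * n + finProdFinEquiv (e x, e y)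
  | link x => n + n * n + n * n + e x
  | queue k => n + n * n + n * n + n + k

theorem addr_adj {x y : N} : (adj x y).addr e = n + n * e x + e y := by
  simp only [addr, finProdFinEquiv_apply_val]
  ring

theorem addr_out {x y : N} : (out x y).addr e = n + n * n + n * e x + e y := by
  simp only [addr, finProdFinEquiv_apply_val]
  ring

theorem addr_injective (e : N ≃ Fin n) : Function.Injective (addr e) := by
  intro c c' h
  have he (x y : N) : e x = e y → x = y := (e.injective ·)
  have hpair (i j : Fin n × Fin n) : finProdFinEquiv i = finProdFinEquiv j → i = j :=
    (finProdFinEquiv.injective ·)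
  cases c <;> cases c' <;> simp only [addr] at h <;> grind [Fin.ext_iff]

end MemCell

namespace RAMState

variable {N : Type*} {n : ℕ} {e : N ≃ Fin n} {σ : RAMState} {c c' : MemCell N} {i v : ℕ}

/-- The content of a memory cell. -/
def cell (e : N ≃ Fin n) (σ : RAMState) (c : MemCell N) : ℕ := σ.mem (c.addr e)

@[simp]
theorem cell_setReg : (σ.setReg i v).cell e c = σ.cell e c := rfl

theorem mem_addr : σ.mem (c.addr e) = σ.cell e c := rfl

theorem mem_node {x : N} : σ.mem (e x) = σ.cell e (.pred x) := rfl

theorem setMem_node {x : N} : σ.setMem (e x) v = σ.setMem ((MemCell.pred x).addr e) v := rfl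

open Classical in
@[simp]
theorem cell_setMem :
    (σ.setMem (c'.addr e) v).cell e c = if c = c' then v else σ.cell e c := by
  simp only [cell, setMem, Function.update_apply, (MemCell.addr_injective e).eq_iff]

end RAMState

namespace FlowNetwork

variable {N : Type u} {F : FlowNetwork N} {n : ℕ} {e : N ≃ Fin n} {p : N → N} {σ : RAMState}

/-- The registers of `σ` that are constant during the max-flow program on `F` have their values:
the number of nodes, the source, the sink, `0`, `1`, and three offsets of memory cells. -/
structure HasConstants (F : FlowNetwork N) (e : N ≃ Fin n) (σ : RAMState) : Prop where
  card : σ.reg rN = n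
  source : σ.reg rSource = e F.source
  sink : σ.reg rSink = e F.sink
  zero : σ.reg rZero = 0
  one : σ.reg rOne = 1
  square : σ.reg rSquare = n * n
  link : σ.reg rLink = n + n * n + n * n
  queue : σ.reg rQueue = n + n * n + n * n + n

namespace HasConstants

theorem congr_reg {σ' : RAMState} (h : F.HasConstants e σ) (hreg : ∀ i < 10, σ'.reg i = σ.reg i) :
    F.HasConstants e σ' := by
  constructor <;> rw [hreg _ (by simp)]
  exacts [h.card, h.source, h.sink, h.zero, h.one, h.square, h.link, h.queue]

@[simp]
theorem setReg_iff {i v : ℕ} (hi : 10 ≤ i) :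
    F.HasConstants e (σ.setReg i v) ↔ F.HasConstants e σ := by
  have hreg (j : ℕ) (hj : j < 10) : (σ.setReg i v).reg j = σ.reg j := by
    rw [RAMState.reg_setReg, if_neg (by omega)]
  exact ⟨fun h => h.congr_reg fun j hj => (hreg j hj).symm, fun h => h.congr_reg hreg⟩

@[simp]
theorem setMem_iff {a v : ℕ} : F.HasConstants e (σ.setMem a v) ↔ F.HasConstants e σ :=
  ⟨fun h => { h with }, fun h => { h with }⟩

theorem link_add (h : F.HasConstants e σ) (x : N) :
    σ.reg rLink + e x = (MemCell.link x).addr e := by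
  rw [h.link, MemCell.addr]

theorem queue_add (h : F.HasConstants e σ) (k : ℕ) :
    σ.reg rQueue + k = (MemCell.queue k : MemCell N).addr e := by
  rw [h.queue, MemCell.addr]

end HasConstants

end FlowNetwork

namespace RAMProgram

/-- `R_row := n + n * R_j`, the address of a row of the adjacency matrix. -/
def rowAddr (j : ℕ) : RAMProgram :=
  block [.add rRow rN rZero, .add rCount j rZero,
    .loop rCount (block [.add rRow rRow rN, .sub rCount rCount rOne])]

/-- Run `P` for each node in `R_node`, which `P` has to preserve. -/
def forNodes (P : RAMProgram) : RAMProgram :=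
  block [.add rNode rN rZero, .loop rNode (block [.sub rNode rNode rOne, P])]

variable {N : Type u} {F : FlowNetwork N} {n : ℕ} {e : N ≃ Fin n} {σ : RAMState}

theorem wp_rowAddr {j v : ℕ} (hn : σ.reg rN = n) (hzero : σ.reg rZero = 0) (hone : σ.reg rOne = 1)
    (hjv : σ.reg j = v) (hj : j ≠ rRow) (hv : v ≤ n) :
    wp (rowAddr j) (fun σ' k => k ≤ 3 * n + 3 ∧
      σ' = (σ.setReg rRow (n + n * v)).setReg rCount 0) σ := by
  have hloop := wp_countdown (i := rCount) (c := 2) (v := v)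
    (P := block [.add rRow rRow rN, .sub rCount rCount rOne])
    (σ := (σ.setReg rRow n).setReg rCount v)
    (fun u σ' => u ≤ v ∧ σ' = (σ.setReg rRow (n + n * (v - u))).setReg rCount u) ?_ ?_ (by simp)
  · simp only [rowAddr, block, wp, hn, hzero, hjv, hj, RAMState.reg_setReg, add_zero, if_false]
    refine wp_mono hloop ?_
    rintro σ' k ⟨hk, -, h'⟩
    exact ⟨by omega, h'⟩
  · rintro u _ ⟨-, rfl⟩
    simp
  · rintro u hu _ ⟨-, rfl⟩
    have hmul : n + n * (v - (u + 1)) + n = n + n * (v - u) := by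
      rw [add_assoc, ← Nat.mul_succ]
      congr 2
      omega
    simp only [block, wp, RAMState.reg_setReg, reduceIte, Nat.reduceEqDiff, hn, hone, hmul,
      Nat.reduceAdd, le_refl, add_tsub_cancel_right, true_and]
    refine ⟨hu.le, ?_⟩
    simp only [RAMState.setReg]
    rw [Function.update_comm (a := rCount) (b := rRow) (by decide), Function.update_idem,
      Function.update_idem]

theorem wp_forNodes {P : RAMProgram} {c : ℕ} (I : Set N → RAMState → Prop)
    (hconst : ∀ S σ, I S σ → F.HasConstants e σ)
    (hnode : ∀ S σ v, I S σ → I S (σ.setReg rNode v))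
    (hP : ∀ S σ x, x ∉ S → I S σ → σ.reg rNode = e x →
      wp P (fun σ' k => k ≤ c ∧ σ'.reg rNode = e x ∧ I (insert x S) σ') σ)
    (h : I ∅ σ) :
    wp (forNodes P) (fun σ' k => k ≤ (c + 2) * n + 2 ∧ I Set.univ σ') σ := by
  have hσ := hconst _ _ h
  have hloop := wp_countdown (i := rNode) (c := c + 1) (v := n)
    (P := block [.sub rNode rNode rOne, P]) (σ := σ.setReg rNode n)
    (fun v σ => σ.reg rNode = v ∧ I {x | v ≤ e x} σ) (fun _ _ hv => hv.1) ?_ ?_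
  · simp only [forNodes, block, wp, hσ.card, hσ.zero, add_zero]
    refine wp_mono hloop ?_
    rintro σ' k ⟨hk, -, h'⟩
    exact ⟨by linarith, by simpa using h'⟩
  · rintro v hv σ ⟨hreg, h⟩
    have hS : insert (e.symm ⟨v, hv⟩) {x | v + 1 ≤ e x} = {x | v ≤ (e x : ℕ)} := by
      ext x
      simp only [Set.mem_insert_iff, Equiv.eq_symm_apply, Fin.ext_iff, Set.mem_ofPred_eq]
      omega
    simp only [block, wp, hreg, (hconst _ _ h).one, Nat.add_sub_cancel]
    refine wp_mono (hP _ _ (e.symm ⟨v, hv⟩) (by simp) (hnode _ _ v h) (by simp)) ?_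
    rintro σ' k ⟨hk, hreg', h'⟩
    exact ⟨by omega, by simpa using hreg', hS ▸ h'⟩
  · refine ⟨by simp, ?_⟩
    convert hnode _ _ n h
    ext x
    simp

end RAMProgram

namespace FlowNetwork

variable {N : Type u} {F : FlowNetwork N} {n : ℕ} {e : N ≃ Fin n} {p : N → N} {σ : RAMState}

/-- The state `σ` holds the predecessor map `p` and, as adjacency matrix, the reflexive closure of
the edges of `F`, and the output is still zero. -/
structure Represents (F : FlowNetwork N) (e : N ≃ Fin n) (p : N → N) (σ : RAMState) : Prop
    extends F.HasConstants e σ where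
  pred : ∀ x, σ.cell e (.pred x) = e (p x)
  adj : ∀ x y, σ.cell e (.adj x y) ≠ 0 ↔ Relation.ReflGen F.edge x y
  out : ∀ x y, σ.cell e (.out x y) = 0

theorem represents_iff : F.Represents e p σ ↔ F.HasConstants e σ ∧
    (∀ x, σ.cell e (.pred x) = e (p x)) ∧
    (∀ x y, σ.cell e (.adj x y) ≠ 0 ↔ Relation.ReflGen F.edge x y) ∧
    ∀ x y, σ.cell e (.out x y) = 0 :=
  ⟨fun h => ⟨h.1, h.2, h.3, h.4⟩, fun h => ⟨h.1, h.2.1, h.2.2.1, h.2.2.2⟩⟩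

namespace Represents

@[simp]
theorem setReg_iff {i v : ℕ} (hi : 10 ≤ i) :
    F.Represents e p (σ.setReg i v) ↔ F.Represents e p σ := by
  simp [represents_iff, hi]

@[simp]
theorem setMem_link_iff {x : N} {v : ℕ} :
    F.Represents e p (σ.setMem ((MemCell.link x).addr e) v) ↔ F.Represents e p σ := by
  simp [represents_iff]

@[simp]
theorem setMem_queue_iff {k v : ℕ} :
    F.Represents e p (σ.setMem ((MemCell.queue k : MemCell N).addr e) v) ↔
      F.Represents e p σ := by
  simp [represents_iff]

theorem setMem_pred [DecidableEq N] (h : F.Represents e p σ) (x y : N) :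
    F.Represents e (Function.update p x y) (σ.setMem ((MemCell.pred x).addr e) (e y)) := by
  refine represents_iff.2 ⟨by simpa using h.toHasConstants, fun z => ?_, by simpa using h.adj,
    by simpa using h.out⟩
  by_cases hz : z = x <;> simp [hz, h.pred]

end Represents

theorem cell_input_adj (x y : N) : (F.input e).cell e (.adj x y) ≠ 0 ↔ F.edge x y := by
  simp [RAMState.cell, input, MemCell.addr, -finProdFinEquiv_apply_val]

theorem cell_input_out (x y : N) : (F.input e).cell e (.out x y) = 0 := by
  simp only [RAMState.cell, input, MemCell.addr]
  rw [dif_neg (by omega), dif_neg (by omega)]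

end FlowNetwork

namespace RAMProgram

open FlowNetwork

variable {N : Type u} {F : FlowNetwork N} {n : ℕ} {e : N ≃ Fin n} {p : N → N} {σ : RAMState}

/-- Set the constant registers. -/
def setRegisters : RAMProgram :=
  block [.const rOne 1, rowAddr rN, .sub rSquare rRow rN, .add rLink rRow rSquare,
    .add rQueue rLink rN]

theorem wp_setRegisters :
    wp setRegisters (fun σ' k => k ≤ 3 * n + 7 ∧
      F.HasConstants e σ' ∧ σ'.mem = (F.input e).mem) (F.input e) := by
  simp only [setRegisters, block, wp]
  refine wp_mono (wp_rowAddr (n := n) (v := n) rfl rfl rfl rfl (by decide) le_rfl) ?_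
  rintro _ k ⟨hk, rfl⟩
  refine ⟨by omega, ⟨?_, ?_, ?_, ?_, ?_, ?_, ?_, ?_⟩, rfl⟩ <;>
    simp [input, add_assoc]

/-- Start from the identity as predecessor map, and make the adjacency matrix reflexive. -/
def initArrays : RAMProgram :=
  forNodes (block [.store rNode rNode, rowAddr rNode, .add rRow rRow rNode, .store rRow rOne])

theorem wp_initArrays (h : F.HasConstants e σ) (hmem : σ.mem = (F.input e).mem) :
    wp initArrays (fun σ' k => k ≤ (3 * n + 10) * n + 2 ∧ F.Represents e id σ') σ := by
  classical
  have hcell (c : MemCell N) : σ.cell e c = (F.input e).cell e c := congrFun hmem _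
  refine wp_mono (wp_forNodes (c := 3 * n + 8) (F := F) (e := e) (fun S σ' => F.HasConstants e σ' ∧
    (∀ x ∈ S, σ'.cell e (.pred x) = e x) ∧
    (∀ x y, σ'.cell e (.adj x y) ≠ 0 ↔ F.edge x y ∨ x = y ∧ x ∈ S) ∧
    ∀ x y, σ'.cell e (.out x y) = 0) (fun _ _ h => h.1)
    (by simp +contextual) ?_ ?_) ?_
  · rintro S σ x - ⟨hσ, hpred, hadj, hout⟩ hx
    simp only [block, wp, hx, RAMState.reg_setMem]
    refine wp_mono (wp_rowAddr hσ.card hσ.zero hσ.one hx (by decide) (e x).isLt.le) ?_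
    rintro _ k ⟨hk, rfl⟩
    refine ⟨by omega, by simpa using hx, ?_⟩
    simp only [RAMState.setMem_node, RAMState.setReg_setMem, RAMState.reg_setReg,
      RAMState.reg_setMem, RAMState.cell_setReg, RAMState.cell_setMem, HasConstants.setReg_iff,
      HasConstants.setMem_iff, reduceIte, Nat.succ_ne_self, Nat.reduceEqDiff, Nat.reduceLeDiff,
      ← MemCell.addr_adj, hx, hσ, hσ.one, Set.mem_insert_iff, MemCell.pred.injEq,
      MemCell.adj.injEq, reduceCtorEq, forall_eq_or_imp, true_and, ne_eq]
    grind
  · exact ⟨h, by simp, by simpa [hcell] using cell_input_adj, by simpa [hcell] using cell_input_out⟩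
  · rintro σ' k ⟨hk, hσ', hpred, hadj, hout⟩
    refine ⟨by linarith, hσ', fun x => hpred x trivial, fun x y => (hadj x y).trans ?_, hout⟩
    rw [Relation.reflGen_iff, eq_comm, and_iff_left (Set.mem_univ x), or_comm]

end RAMProgram

namespace FlowNetwork

variable {N : Type u} {F : FlowNetwork N} {n : ℕ} {e : N ≃ Fin n} {p : N → N} {σ : RAMState}
  {q : List N}

/-- The links and the queue in the memory describe a search tree with nodes `q`, in the order in
which they were reached from the source. In it `x` is a child of `w` if there is an edge from `p w`
to `x`, or `x = p w`: then `p w` may become the predecessor of `x` in place of that of `w`. -/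
structure SearchTree (F : FlowNetwork N) (e : N ≃ Fin n) (p : N → N) (q : List N) (σ : RAMState) :
    Prop where
  nodup : q.Nodup
  head : q[0]? = some F.source
  sink_notMem : F.sink ∉ q
  queue : ∀ k x, q[k]? = some x → σ.cell e (.queue k) = e x
  link : ∀ x, σ.cell e (.link x) ≠ 0 ↔ x ∈ q
  parent : ∀ k x, q[k + 1]? = some x → ∃ j ≤ k, ∃ w, q[j]? = some w ∧
    σ.cell e (.link x) = j + 1 ∧ Relation.ReflGen F.edge (p w) x

namespace SearchTree

theorem congr_cell {σ' : RAMState} (h : F.SearchTree e p q σ)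
    (hqueue : ∀ k, σ'.cell e (.queue k) = σ.cell e (.queue k))
    (hlink : ∀ x, σ'.cell e (.link x) = σ.cell e (.link x)) : F.SearchTree e p q σ' :=
  { h with
    queue := by simpa only [hqueue] using h.queue
    link := by simpa only [hlink] using h.link
    parent := by simpa only [hlink] using h.parent }

@[simp]
theorem setReg_iff {i v : ℕ} : F.SearchTree e p q (σ.setReg i v) ↔ F.SearchTree e p q σ :=
  ⟨fun h => { h with }, fun h => { h with }⟩

@[simp]
theorem setMem_pred_iff {x : N} {v : ℕ} :
    F.SearchTree e p q (σ.setMem ((MemCell.pred x).addr e) v) ↔ F.SearchTree e p q σ :=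
  ⟨fun h => h.congr_cell (by simp) (by simp), fun h => h.congr_cell (by simp) (by simp)⟩

theorem length_le (h : F.SearchTree e p q σ) : q.length ≤ n := by
  have := Fintype.ofEquiv _ e.symm
  simpa [Fintype.card_congr e] using h.nodup.length_le_card

theorem eq_of_getElem?_eq (h : F.SearchTree e p q σ) {j k : ℕ} {x : N} (hj : q[j]? = some x)
    (hk : q[k]? = some x) : j = k :=
  (List.getElem?_inj (List.getElem?_eq_some_iff.1 hj).1 h.nodup).1 (hj.trans hk.symm)

theorem singleton (hF : F.source ≠ F.sink) (hlink : ∀ x, σ.cell e (.link x) = 0) :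
    F.SearchTree e p [F.source] ((σ.setMem ((MemCell.link F.source).addr e) 1).setMem
      ((MemCell.queue 0 : MemCell N).addr e) (e F.source)) := by
  classical
  constructor <;> simp [hF.symm, hlink, List.getElem?_singleton]

theorem push (h : F.SearchTree e p q σ) {i : ℕ} {w z : N} (hw : q[i]? = some w) (hz : z ∉ q)
    (hsink : z ≠ F.sink) (hwz : Relation.ReflGen F.edge (p w) z) :
    F.SearchTree e p (q ++ [z]) ((σ.setMem ((MemCell.link z).addr e) (i + 1)).setMem
      ((MemCell.queue q.length : MemCell N).addr e) (e z)) := by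
  classical
  have hget {k : ℕ} {x : N} : (q ++ [z])[k]? = some x ↔ q[k]? = some x ∨ k = q.length ∧ x = z := by
    rw [List.getElem?_append]
    grind
  have hi := (List.getElem?_eq_some_iff.1 hw).1
  refine ⟨?_, hget.2 (.inl h.head), ?_, fun k x hx => ?_, fun x => ?_, fun k x hx => ?_⟩
  · simpa [List.nodup_append, h.nodup] using fun a ha (e : a = z) => hz (e ▸ ha)
  · simpa [h.sink_notMem] using hsink.symm
  · rcases hget.1 hx with hx | ⟨rfl, rfl⟩
    · simp [(List.getElem?_eq_some_iff.1 hx).1.ne, h.queue k x hx]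
    · simp
  · by_cases hxz : x = z <;> simp [hxz, h.link]
  · rcases hget.1 hx with hx | ⟨hk, rfl⟩
    · have hxz : x ≠ z := fun e => hz (e ▸ List.mem_of_getElem? hx)
      obtain ⟨j, hj, w', hw', hlink, hstep⟩ := h.parent k x hx
      exact ⟨j, hj, w', hget.2 (.inl hw'), by simpa [hxz] using hlink, hstep⟩
    · exact ⟨i, by omega, w, hget.2 (.inl hw), by simp, hwz⟩

end SearchTree

variable {i : ℕ}

/-- A state during a search for an augmentation of `p`: the nodes `q` have been reached so far, and
the first `i` of them have been processed. -/
structure SearchState (F : FlowNetwork N) (e : N ≃ Fin n) (p : N → N) (q : List N) (i : ℕ)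
    (σ : RAMState) : Prop where
  represents : F.Represents e p σ
  tree : F.SearchTree e p q σ
  tail : σ.reg rTail = q.length
  head : σ.reg rHead = i

@[simp]
theorem SearchState.setReg_iff {j v : ℕ} (hj : 10 ≤ j) (htail : j ≠ rTail) (hhead : j ≠ rHead) :
    F.SearchState e p q i (σ.setReg j v) ↔ F.SearchState e p q i σ := by
  have htail' : (σ.setReg j v).reg rTail = σ.reg rTail := by simp [htail.symm]
  have hhead' : (σ.setReg j v).reg rHead = σ.reg rHead := by simp [hhead.symm]
  exact ⟨fun h => ⟨(Represents.setReg_iff hj).1 h.1, SearchTree.setReg_iff.1 h.2, htail' ▸ h.3,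
    hhead' ▸ h.4⟩, fun h => ⟨(Represents.setReg_iff hj).2 h.1, SearchTree.setReg_iff.2 h.2,
    htail'.trans h.3, hhead'.trans h.4⟩⟩

end FlowNetwork

namespace RAMProgram

open FlowNetwork

variable {N : Type u} {F : FlowNetwork N} {n : ℕ} {e : N ≃ Fin n} {p : N → N} {σ : RAMState}
  {q : List N} {i : ℕ}

/-- Empty the search tree. -/
def clearLinks : RAMProgram :=
  forNodes (block [.add rA rLink rNode, .store rA rZero])

theorem wp_clearLinks (h : F.Represents e p σ) :
    wp clearLinks (fun σ' k => k ≤ 4 * n + 2 ∧ F.Represents e p σ' ∧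
      ∀ x, σ'.cell e (.link x) = 0) σ := by
  classical
  refine wp_mono (wp_forNodes (c := 2) (F := F) (e := e) (fun S σ' => F.Represents e p σ' ∧
    ∀ x ∈ S, σ'.cell e (.link x) = 0) (fun _ _ h => h.1.toHasConstants) (by simp) ?_
    ⟨h, by simp⟩) (by simp)
  rintro S σ x - ⟨hσ, hlink⟩ hx
  simp only [block, wp, hx, hσ.link_add, hσ.zero, RAMState.reg_setReg, RAMState.setReg_setMem]
  simp only [Nat.reduceAdd, Nat.reduceEqDiff, Nat.reduceLeDiff, Std.le_refl, reduceIte, hx, hσ,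
    RAMState.reg_setMem, RAMState.cell_setReg, RAMState.cell_setMem, Represents.setReg_iff,
    Represents.setMem_link_iff, MemCell.link.injEq, Set.mem_insert_iff, ite_eq_left_iff,
    forall_eq_or_imp, not_true_eq_false, IsEmpty.forall_iff, true_and]
  grind

/-- Add to the search tree, as children of the node at the head of the queue, the nodes that are
not yet in it and have a nonzero entry in the row of the adjacency matrix at the address `R_row`. -/
def scanRow : RAMProgram :=
  forNodes (block [.add rA rLink rNode, .load rA rA, .ite rA .skip (block
    [.add rB rRow rNode, .load rB rB, .ite rB (block
      [.add rA rLink rNode, .add rB rHead rOne, .store rA rB,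
        .add rA rQueue rTail, .store rA rNode, .add rTail rTail rOne]) .skip])])

theorem wp_scanRow {w : N} (h : F.SearchState e p q i σ) (hw : q[i]? = some w)
    (hrow : σ.reg rRow = n + n * e (p w)) (hsink : ¬ Relation.ReflGen F.edge (p w) F.sink) :
    wp scanRow (fun σ' k => k ≤ 14 * n + 2 ∧ ∃ q', q <+: q' ∧ F.SearchState e p q' i σ' ∧
      ∀ z, Relation.ReflGen F.edge (p w) z → z ∈ q') σ := by
  classical
  refine wp_mono (wp_forNodes (c := 12) (F := F) (e := e) (fun S σ' =>
    σ'.reg rRow = n + n * e (p w) ∧ ∃ q', q <+: q' ∧ F.SearchState e p q' i σ' ∧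
      ∀ z ∈ S, Relation.ReflGen F.edge (p w) z → z ∈ q')
    (fun _ _ ⟨_, _, _, h, _⟩ => h.represents.toHasConstants)
    (by simp) ?_ ⟨hrow, q, q.prefix_rfl, h, by simp⟩) (by simp +contextual)
  rintro S σ z - ⟨hrow, q', hq', hσ, hS⟩ hz
  have hlink := hσ.tree.link z
  have hadj := hσ.represents.adj (p w) z
  have hconst := hσ.represents.toHasConstants
  have haddr : n + n * e (p w) + e z = (MemCell.adj (p w) z).addr e := MemCell.addr_adj.symm
  simp only [block, wp, hz, hrow, hconst.link_add, hconst.queue_add, hσ.tail, hσ.head, hconst.one,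
    haddr, RAMState.reg_setReg, RAMState.mem_addr, RAMState.cell_setReg, RAMState.reg_setMem,
    RAMState.setReg_setMem, reduceIte, Nat.reduceEqDiff]
  split_ifs with hzq hwz
  · refine ⟨by omega, trivial, trivial, q', hq', by simpa using hσ, ?_⟩
    grind
  · have hzt : z ≠ F.sink := fun hz => hsink (hz ▸ hadj.1 hwz)
    have hw' : q'[i]? = some w := by
      obtain ⟨hi, rfl⟩ := List.getElem?_eq_some_iff.1 hw
      exact List.prefix_iff_getElem?.1 hq' i hi
    refine ⟨by omega, trivial, trivial, q' ++ [z], hq'.trans (List.prefix_append ..),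
      ⟨by simpa using hσ.represents, ?_, by simp, by simpa using hσ.head⟩, ?_⟩
    · simpa using hσ.tree.push hw' (fun h => hlink.2 h hzq) hzt (hadj.1 hwz)
    · rintro y (rfl | hy) hwy
      · simp
      · exact List.mem_append_left _ (hS y hy hwy)
  · refine ⟨by omega, trivial, trivial, q', hq', by simpa using hσ, ?_⟩
    grind

/-- Look for an edge from the predecessor of the node at the head of the queue to the sink; if there
is none, scan the row of the predecessor and proceed to the next node of the queue. -/
def searchStep : RAMProgram :=
  block [.add rA rQueue rHead, .load rA rA, .load rA rA, rowAddr rA,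
    .add rA rRow rSink, .load rA rA, .ite rA
      (block [.const rFound 1, .const rPending 0])
      (block [scanRow, .const rFound 0, .add rHead rHead rOne, .sub rPending rTail rHead])]

/-- Search for an augmentation. -/
def search : RAMProgram :=
  block [clearLinks, .add rA rLink rSource, .store rA rOne, .store rQueue rSource, .const rTail 1,
    .const rHead 0, .const rFound 0, .const rPending 1, .loop rPending searchStep]

theorem wp_searchStep {w : N} (h : F.SearchState e p q i σ) (hw : q[i]? = some w) :
    wp searchStep (fun σ' k => k ≤ 17 * n + 20 ∧
      (F.SearchState e p q i σ' ∧ σ'.reg rFound = 1 ∧ σ'.reg rPending = 0 ∧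
        Relation.ReflGen F.edge (p w) F.sink ∨
      ∃ q', q <+: q' ∧ F.SearchState e p q' (i + 1) σ' ∧ σ'.reg rFound = 0 ∧
        σ'.reg rPending = q'.length - (i + 1) ∧
        ∀ z, Relation.ReflGen F.edge (p w) z → z ∈ q')) σ := by
  have hconst := h.represents.toHasConstants
  have hadj := h.represents.adj (p w) F.sink
  have haddr : n + n * e (p w) + e F.sink = (MemCell.adj (p w) F.sink).addr e :=
    MemCell.addr_adj.symm
  simp only [searchStep, block, wp, hconst.queue_add, h.head, RAMState.reg_setReg, reduceIte,
    RAMState.mem_setReg, RAMState.mem_addr, RAMState.cell_setReg, h.tree.queue i w hw,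
    RAMState.mem_node, h.represents.pred]
  refine wp_mono (wp_rowAddr (n := n) (v := e (p w)) ?_ ?_ ?_ ?_ (by decide) (e (p w)).isLt.le) ?_
  · simp [hconst.card]
  · simp [hconst.zero]
  · simp [hconst.one]
  · simp
  · rintro _ k ⟨hk, rfl⟩
    simp only [RAMState.reg_setReg, Nat.reduceEqDiff, reduceIte, hconst.sink, haddr,
      RAMState.mem_addr]
    split_ifs with hsink
    · refine wp_mono (wp_scanRow (by simpa using h) hw (by simp) (fun hs => hadj.2 hs hsink)) ?_
      rintro σ' l ⟨hl, q', hq', hσ', hz⟩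
      refine ⟨by omega, .inr ⟨q', hq', ⟨?_, ?_, ?_, ?_⟩, ?_, ?_, hz⟩⟩
      · simp [hσ'.represents]
      · simp [hσ'.tree]
      · simp [hσ'.tail]
      · simp [hσ'.head, hσ'.represents.one]
      · simp
      · simp [hσ'.tail, hσ'.head, hσ'.represents.one]
    · exact ⟨by omega, .inl ⟨by simpa using h, by simp, by simp, hadj.1 hsink⟩⟩

theorem wp_loop_searchStep (h : F.SearchState e p [F.source] 0 σ) (hfound : σ.reg rFound = 0)
    (hpending : σ.reg rPending = 1) :
    wp (.loop rPending searchStep) (fun σ' k => k ≤ (17 * n + 21) * n + 1 ∧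
      ∃ q i, F.SearchState e p q i σ' ∧ (σ'.reg rFound = 0 ∧ F.IsBarrier p {z | z ∈ q} ∨
        σ'.reg rFound = 1 ∧ ∃ w, q[i]? = some w ∧ Relation.ReflGen F.edge (p w) F.sink)) σ := by
  refine wp_mono (wp_loop (c := 17 * n + 20) (fun v σ => ∃ q i, F.SearchState e p q i σ ∧
    (σ.reg rFound = 0 ∧ σ.reg rPending = q.length - i ∧ v = n - i ∧
      (∀ a ∈ q.take i, ∀ z, Relation.ReflGen F.edge (p a) z → z ∈ q) ∨
    σ.reg rFound = 1 ∧ σ.reg rPending = 0 ∧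
      ∃ w, q[i]? = some w ∧ Relation.ReflGen F.edge (p w) F.sink)) ?_ n ?_) ?_
  · rintro v σ ⟨q, i, hσ, ⟨-, hpending, rfl, hclosed⟩ | ⟨-, hpending, -⟩⟩ hpos
    · have hi : i < q.length := by omega
      have hn := hσ.tree.length_le
      refine wp_mono (wp_searchStep hσ (List.getElem?_eq_getElem hi)) ?_
      rintro σ' k ⟨hk, ⟨hσ', hfound, hpending, hsink⟩ | ⟨_, ⟨r, rfl⟩, hσ', hfound, hpending, hz⟩⟩
      · exact ⟨hk, 0, by omega, q, i, hσ', .inr ⟨hfound, hpending, _, by simp [hi], hsink⟩⟩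
      · refine ⟨hk, _, by omega, _, i + 1, hσ', .inl ⟨hfound, hpending, rfl, ?_⟩⟩
        rw [List.take_append_of_le_length hi, List.take_add_one, List.getElem?_eq_getElem hi]
        simp only [List.mem_append] at hclosed ⊢
        rintro a (ha | ha) z haz
        · exact .inl (hclosed a ha z haz)
        · obtain rfl : a = q[i] := by simpa using ha
          simpa using hz z haz
    · exact absurd hpending hpos
  · exact ⟨_, 0, h, .inl ⟨hfound, by simp [hpending], by simp, by simp⟩⟩
  · rintro σ' k ⟨hk, hpending, v, q, i, hσ', ⟨hfound, hlen, -, hclosed⟩ | ⟨hfound, -, hw⟩⟩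
    · rw [List.take_of_length_le (by omega)] at hclosed
      refine ⟨hk, q, i, hσ', .inl ⟨hfound, List.mem_of_getElem? hσ'.tree.head,
        hσ'.tree.sink_notMem, fun a ha hsink => ?_, hclosed⟩⟩
      exact hσ'.tree.sink_notMem (hclosed a ha _ (.single hsink))
    · exact ⟨hk, q, i, hσ', .inr ⟨hfound, hw⟩⟩

theorem wp_search (h : F.Represents e p σ) (hF : F.source ≠ F.sink) :
    wp search (fun σ' k => k ≤ (17 * n + 25) * n + 10 ∧
      ∃ q i, F.SearchState e p q i σ' ∧ (σ'.reg rFound = 0 ∧ F.IsBarrier p {z | z ∈ q} ∨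
        σ'.reg rFound = 1 ∧ ∃ w, q[i]? = some w ∧ Relation.ReflGen F.edge (p w) F.sink)) σ := by
  simp only [search, block, wp]
  refine wp_mono (wp_clearLinks h) ?_
  rintro σ k ⟨hk, hσ, hlink⟩
  have hqueueAddr : σ.reg rQueue = (MemCell.queue 0 : MemCell N).addr e := hσ.queue
  refine wp_mono (wp_loop_searchStep (F := F) (e := e) (p := p) ⟨?_, ?_, ?_, ?_⟩ ?_ ?_) ?_
  · simpa [hσ.source, hσ.link_add, hqueueAddr] using hσ
  · simpa [hσ.source, hσ.link_add, hqueueAddr, hσ.one] using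
      SearchTree.singleton (p := p) hF hlink
  · simp
  · simp
  · simp
  · simp
  · rintro σ' l ⟨hl, hσ'⟩
    exact ⟨by linarith, hσ'⟩

end RAMProgram

namespace FlowNetwork

variable {N : Type u} {F : FlowNetwork N} {p : N → N}

theorem IsLinkage.ncard_ends_extend [Finite N] (h : F.IsLinkage p ∅) {y : N} (hy : p y ≠ F.source) :
    (ends p (F.hole y)).ncard = (ends p ∅).ncard + 1 := by
  rw [ends_extend h hy, Set.ncard_insert_of_notMem fun hmem => mem_ends_empty.1 hmem y rfl]

theorem IsLinkage.edge_sink (h : F.IsLinkage p ∅) (hF : F.IsUnitCapacity) {w : N} (hw : w ≠ F.sink)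
    (hsink : Relation.ReflGen F.edge (p w) F.sink) : p w ≠ F.source ∧ F.edge (p w) F.sink := by
  have hs : p w ≠ F.source := fun hs => by
    rw [hs, Relation.reflGen_iff] at hsink
    exact hsink.elim (hF.source_ne_sink ·.symm) hF.not_edge
  have ht : F.sink ≠ p w := fun ht =>
    hw (h.inj w (by simp) F.sink (by simp) (ht.symm.trans h.sink.symm) hs)
  exact ⟨hs, ((Relation.reflGen_iff ..).1 hsink).resolve_left ht⟩

end FlowNetwork

namespace RAMProgram

open FlowNetwork

variable {N : Type u} {F : FlowNetwork N} {n : ℕ} {e : N ≃ Fin n} {p : N → N} {σ : RAMState}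
  {q : List N} {i : ℕ}

/-- Replace the predecessor of the node at the head of the queue by that of its parent in the search
tree, and make the parent the head. -/
def augmentStep : RAMProgram :=
  block [.add rA rQueue rHead, .load rA rA, .add rB rLink rA, .load rB rB,
    .sub rHead rB rOne, .add rB rQueue rHead, .load rB rB, .load rB rB, .store rA rB]

/-- Move the predecessors along the path of the search tree from the source to the head. -/
def augment : RAMProgram := .loop rHead augmentStep

theorem wp_augmentStep [DecidableEq N] {p' : N → N} {v j : ℕ} {y a : N}
    (hσ : F.Represents e p' σ) (h : F.SearchTree e p q σ) (hhead : σ.reg rHead = v)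
    (hy : q[v]? = some y) (ha : q[j]? = some a) (hlink : σ.cell e (.link y) = j + 1) :
    wp augmentStep (fun σ' k => k ≤ 9 ∧ σ'.reg rHead = j ∧ F.SearchTree e p q σ' ∧
      F.Represents e (Function.update p' y (p' a)) σ') σ := by
  have hσ' := hσ.setMem_pred y (p' a)
  simp only [augmentStep, block, wp, hhead, hσ.queue_add, hσ.link_add, RAMState.reg_setReg,
    RAMState.mem_addr, RAMState.cell_setReg, h.queue _ _ hy, h.queue _ _ ha, hlink, hσ.one,
    hσ.pred, RAMState.mem_node, RAMState.setMem_node, reduceIte, Nat.reduceEqDiff,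
    RAMState.setReg_setMem, Nat.add_sub_cancel]
  exact ⟨by omega, trivial, by simpa using h, by simpa using hσ'⟩

theorem wp_augment (hF : F.IsUnitCapacity) (hp : F.IsLinkage p ∅) (h : F.SearchState e p q i σ)
    {w : N} (hw : q[i]? = some w) (hsink : Relation.ReflGen F.edge (p w) F.sink) :
    wp augment (fun σ' k => k ≤ 10 * n + 1 ∧ ∃ p', F.Represents e p' σ' ∧ F.IsLinkage p' ∅ ∧
      (ends p' ∅).ncard = (ends p ∅).ncard + 1) σ := by
  classical
  have := Finite.of_equiv _ e.symm
  have hn := h.tree.length_le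
  have hi := (List.getElem?_eq_some_iff.1 hw).1
  refine wp_mono (wp_loop (c := 9) (fun v σ => σ.reg rHead = v ∧ F.SearchTree e p q σ ∧
    ∃ p' y, F.Represents e p' σ ∧ q[v]? = some y ∧ F.IsLinkage p' (F.hole y) ∧
      (ends p' (F.hole y)).ncard = (ends p ∅).ncard + 1 ∧
      ∀ j ≤ v, ∀ a, q[j]? = some a → p' a = p a) ?_ i ?_) ?_
  · rintro v σ ⟨hhead, htree, p', y, hσ, hy, hp', hcard, heq⟩ hpos
    obtain ⟨k, rfl⟩ := Nat.exists_eq_add_one_of_ne_zero (hhead ▸ hpos)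
    obtain ⟨j, hj, a, ha, hlink, hstep⟩ := htree.parent k y hy
    have ne_of_getElem? {l : ℕ} {b : N} (hl : l ≤ k) (hb : q[l]? = some b) : b ≠ y := by
      rintro rfl
      exact absurd (htree.eq_of_getElem?_eq hb hy) (by omega)
    have hay : a ≠ y := ne_of_getElem? hj ha
    have hys : y ≠ F.source := (ne_of_getElem? k.zero_le htree.head).symm
    have hyt : y ≠ F.sink := fun h => htree.sink_notMem (h ▸ List.mem_of_getElem? hy)
    rw [← heq j (by omega) a ha] at hstep
    refine wp_mono (wp_augmentStep hσ htree hhead hy ha hlink) ?_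
    rintro σ' l ⟨hl, hhead', htree', hσ'⟩
    refine ⟨hl, j, by omega, hhead', htree', _, a, hσ', ha, hp'.shift hay hys hyt hstep,
      ends_shift hay hys ▸ hcard, fun l hl b hb => ?_⟩
    rw [Function.update_of_ne (ne_of_getElem? (hl.trans hj) hb), heq l (by omega) b hb]
  · obtain ⟨hws, hwt⟩ := hp.edge_sink hF (fun e => h.tree.sink_notMem (e ▸ List.mem_of_getElem? hw))
      hsink
    exact ⟨h.head, h.tree, p, w, h.represents, hw, hp.extend hws hwt,
      hp.ncard_ends_extend hws, fun _ _ _ _ => rfl⟩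
  · rintro σ' k ⟨hk, hhead, v, hv, htree, p', y, hσ', hy, hp', hcard, -⟩
    obtain rfl : y = F.source := by
      rw [← hv, hhead, htree.head] at hy
      exact (Option.some.inj hy).symm
    rw [hole_source] at hp' hcard
    exact ⟨by omega, p', hσ', hp', hcard⟩

/-- Augment the linkage until the search fails. -/
def augmentAll : RAMProgram :=
  block [.const rFound 1, .loop rFound (block
    [search, .ite rFound (block [augment, .const rFound 1]) .skip])]

theorem wp_augmentAll (hF : F.IsUnitCapacity) (h : F.Represents e id σ) :
    wp augmentAll (fun σ' k => k ≤ ((17 * n + 35) * n + 15) * (n + 1) + 2 ∧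
      ∃ p W, F.Represents e p σ' ∧ F.IsLinkage p ∅ ∧ F.IsBarrier p W) σ := by
  have := Finite.of_equiv _ e.symm
  have hends (p : N → N) : (ends p ∅).ncard ≤ n := by
    simpa [Nat.card_congr e] using Set.ncard_le_card (ends p ∅)
  simp only [augmentAll, block, wp]
  refine wp_mono (wp_loop (c := (17 * n + 35) * n + 14) (fun v σ => ∃ p,
    F.Represents e p σ ∧ F.IsLinkage p ∅ ∧ (σ.reg rFound = 0 ∧ (∃ W, F.IsBarrier p W) ∨
        σ.reg rFound = 1 ∧ v + (ends p ∅).ncard = n + 1)) ?_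
    (n + 1 - (ends (id : N → N) ∅).ncard) ?_) ?_
  · rintro v σ ⟨p, hσ, hp, ⟨hfound, -⟩ | ⟨-, hv⟩⟩ hpos
    · exact absurd hfound hpos
    have := hends p
    simp only [wp]
    refine wp_mono (wp_search hσ hF.source_ne_sink) ?_
    rintro σ' k ⟨hk, q, i, hσ', ⟨hfound, hW⟩ | ⟨hfound, w, hw, hsink⟩⟩
    · rw [if_pos hfound]
      exact ⟨by linarith, 0, by omega, p, hσ'.represents, hp, .inl ⟨hfound, _, hW⟩⟩
    · rw [if_neg (by omega)]
      refine wp_mono (wp_augment hF hp hσ' hw hsink) ?_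
      rintro σ'' l ⟨hl, p', hσ'', hp', hcard⟩
      exact ⟨by linarith, v - 1, by omega, p', by simpa using hσ'', hp',
        .inr ⟨by simp, by omega⟩⟩
  · have := hends id
    exact ⟨id, by simpa using h, isLinkage_id, .inr ⟨by simp, by omega⟩⟩
  · rintro σ' k ⟨hk, hfound, v, p, hσ', hp, ⟨-, W, hW⟩ | ⟨hfound', -⟩⟩
    · have := Nat.mul_le_mul_left ((17 * n + 35) * n + 14 + 1)
        (Nat.sub_le (n + 1) (ends (id : N → N) ∅).ncard)
      exact ⟨by linarith, p, W, hσ', hp, hW⟩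
    · omega

/-- Write `1` to the output at the pair of nodes `(R_i, R_j)`. -/
def writeOut (i j : ℕ) : RAMProgram :=
  block [rowAddr i, .add rRow rRow rSquare, .add rRow rRow j, .store rRow rOne]

/-- For each node, mark its predecessor, and send one unit of flow from there to the node unless
they are the same. -/
def writePaths : RAMProgram :=
  forNodes (block [.load rA rNode, .add rB rLink rA, .store rB rOne, .sub rB rA rNode,
    .sub rPending rNode rA, .add rB rB rPending, .ite rB (writeOut rA rNode) .skip])

/-- Send one unit of flow from node `R_node` to the sink and count this node, if it is unmarked. -/
def writeEnd : RAMProgram :=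
  block [.add rA rLink rNode, .load rA rA,
    .ite rA .skip (block [writeOut rNode rSink, .add rSize rSize rOne])]

/-- Send one unit of flow from each unmarked node to the sink, and count these nodes. -/
def writeEnds : RAMProgram :=
  block [.const rSize 0, forNodes writeEnd]

/-- A max-flow program for networks with unit node capacities. -/
def maxFlow : RAMProgram :=
  block [setRegisters, initArrays, augmentAll, clearLinks, writePaths, writeEnds,
    .add rN rSize rZero]

open Classical in
theorem wp_writeOut {i j : ℕ} {x y : N} (h : F.HasConstants e σ) (hi : σ.reg i = e x)
    (hj : σ.reg j = e y) (hirow : i ≠ rRow) (hjrow : j ≠ rRow) (hjcount : j ≠ rCount) :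
    wp (writeOut i j) (fun σ' k => k ≤ 3 * n + 6 ∧
      F.HasConstants e σ' ∧ (∀ c, σ'.cell e c = if c = .out x y then 1 else σ.cell e c) ∧
      ∀ l, l ≠ rRow → l ≠ rCount → σ'.reg l = σ.reg l) σ := by
  simp only [writeOut, block, wp]
  refine wp_mono (wp_rowAddr h.card h.zero h.one hi hirow (e x).isLt.le) ?_
  rintro _ k ⟨hk, rfl⟩
  have haddr : n + n * e x + n * n + e y = (MemCell.out x y).addr e := by
    rw [MemCell.addr_out]
    ring
  simp only [RAMState.reg_setReg, RAMState.reg_setMem, reduceIte, Nat.reduceEqDiff, hj, hjrow,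
    hjcount, haddr, h.square, h.one]
  exact ⟨by omega, by simpa using h, by simp, by simp +contextual⟩

open Classical in
theorem wp_writePaths (h : F.Represents e p σ) (hlink : ∀ x, σ.cell e (.link x) = 0) :
    wp writePaths (fun σ' k => k ≤ (3 * n + 15) * n + 2 ∧ F.HasConstants e σ' ∧
      (∀ x, σ'.cell e (.link x) = 0 ↔ x ∈ ends p ∅) ∧
      ∀ x y, σ'.cell e (.out x y) = if p y = x ∧ x ≠ y then 1 else 0) σ := by
  refine wp_mono (wp_forNodes (c := 3 * n + 13) (F := F) (e := e) (fun S σ' => F.HasConstants e σ' ∧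
    (∀ x, σ'.cell e (.pred x) = e (p x)) ∧
    (∀ x, σ'.cell e (.link x) = 0 ↔ ∀ y ∈ S, p y ≠ x) ∧
    ∀ x y, σ'.cell e (.out x y) = if y ∈ S ∧ p y = x ∧ x ≠ y then 1 else 0) (fun _ _ h => h.1)
    (by simp +contextual) ?_ ⟨h.toHasConstants, h.pred, by simp [hlink], by simp [h.out]⟩)
    (by simp +contextual [mem_ends_empty])
  rintro S σ y - ⟨hσ, hpred, hlink, hout⟩ hy
  simp only [block, wp, hy, hσ.link_add, hσ.one, hpred, RAMState.reg_setReg, RAMState.mem_node,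
    RAMState.setReg_setMem, reduceIte, Nat.reduceEqDiff, RAMState.reg_setMem]
  split_ifs with hne
  · have hpy : p y = y := e.injective (by omega)
    refine ⟨by omega, by simp, by simpa using hσ, by simpa using hpred, fun x => ?_, fun x z => ?_⟩
    · simp only [RAMState.cell_setReg, RAMState.cell_setMem, MemCell.link.injEq]
      grind
    · simp only [RAMState.cell_setReg, RAMState.cell_setMem, reduceCtorEq, hout]
      grind
  · have hpy : p y ≠ y := fun h => hne (by simp [h])
    refine wp_mono (wp_writeOut (F := F) (e := e) (x := p y) (y := y) (by simpa using hσ)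
      (by simp) (by simpa using hy) (by decide) (by decide) (by decide)) ?_
    rintro σ' k ⟨hk, hσ', hcell, hreg⟩
    refine ⟨by omega, by simp [hreg, hy], hσ', fun x => ?_, fun x => ?_, fun x z => ?_⟩
    all_goals
      simp only [hcell, RAMState.cell_setReg, RAMState.cell_setMem, MemCell.link.injEq,
        MemCell.out.injEq, reduceCtorEq, hout, hpred]
      grind

open Classical in
/-- A state in which the output array holds the path flow of `p` without its edges into the sink,
except that the ends of paths in `S` are already joined to the sink and counted. -/
structure EndsWritten (F : FlowNetwork N) (e : N ≃ Fin n) (p : N → N) (S : Set N)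
    (σ : RAMState) : Prop where
  const : F.HasConstants e σ
  link : ∀ x, σ.cell e (.link x) = 0 ↔ x ∈ ends p ∅
  size : σ.reg rSize = (S ∩ ends p ∅).ncard
  out : ∀ x y, σ.cell e (.out x y) =
    if p y = x ∧ x ≠ y ∨ y = F.sink ∧ x ∈ S ∩ ends p ∅ then 1 else 0

theorem wp_writeEnd {S : Set N} {x : N} (hx : x ∉ S) (h : EndsWritten F e p S σ)
    (hreg : σ.reg rNode = e x) :
    wp writeEnd (fun σ' k => k ≤ 3 * n + 13 ∧ σ'.reg rNode = e x ∧
      EndsWritten F e p (insert x S) σ') σ := by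
  obtain ⟨hσ, hlink, hsize, hout⟩ := h
  simp only [writeEnd, block, wp, hreg, hσ.link_add, RAMState.reg_setReg, RAMState.mem_addr,
    RAMState.cell_setReg, reduceIte, Nat.reduceEqDiff]
  have := Finite.of_equiv _ e.symm
  split_ifs with hne
  · refine wp_mono (wp_writeOut (F := F) (e := e) (x := x) (y := F.sink) (by simpa using hσ)
      (by simpa using hreg) (by simpa using hσ.sink) (by decide) (by decide) (by decide)) ?_
    rintro σ' k ⟨hk, hσ', hcell, hregs⟩
    have hxp := (hlink x).1 hne
    have hcard : (insert x S ∩ ends p ∅).ncard = (S ∩ ends p ∅).ncard + 1 := by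
      rw [Set.insert_inter_of_mem hxp, Set.ncard_insert_of_notMem (by simp [hx])]
    refine ⟨by omega, by simp [hregs, hreg], by simpa using hσ', ?_, ?_, fun y z => ?_⟩
    · simpa [hcell] using hlink
    · simp [hregs, hsize, hσ.one, hcard]
    · simp only [hcell, RAMState.cell_setReg, MemCell.out.injEq, hout, Set.mem_inter_iff,
        Set.mem_insert_iff]
      grind
  · have hxp : x ∉ ends p ∅ := mt (hlink x).2 hne
    refine ⟨by omega, by simp, by simpa using hσ, hlink, ?_, fun y z => ?_⟩
    · simpa [Set.insert_inter_of_notMem hxp] using hsize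
    · simp only [RAMState.cell_setReg, hout, Set.mem_inter_iff, Set.mem_insert_iff]
      grind

open Classical in
theorem wp_writeEnds (h : F.HasConstants e σ)
    (hlink : ∀ x, σ.cell e (.link x) = 0 ↔ x ∈ ends p ∅)
    (hout : ∀ x y, σ.cell e (.out x y) = if p y = x ∧ x ≠ y then 1 else 0) :
    wp writeEnds (fun σ' k => k ≤ (3 * n + 15) * n + 3 ∧ F.HasConstants e σ' ∧
      σ'.reg rSize = (ends p ∅).ncard ∧
      ∀ x y, (σ'.cell e (.out x y) : ℝ≥0) = F.linkageFlow p x y) σ := by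
  have hsetReg {S : Set N} {τ : RAMState} {v : ℕ} (hτ : EndsWritten F e p S τ) :
      EndsWritten F e p S (τ.setReg rNode v) :=
    ⟨by simpa using hτ.const, hτ.link, by simpa using hτ.size, hτ.out⟩
  have hinit : EndsWritten F e p ∅ (σ.setReg rSize 0) :=
    ⟨by simpa using h, by simpa using hlink, by simp, by simpa using hout⟩
  simp only [writeEnds, block, wp]
  refine wp_mono (wp_forNodes (EndsWritten F e p) (fun _ _ hτ => hτ.const)
    (fun _ _ _ => hsetReg) (fun _ _ _ => wp_writeEnd) hinit) ?_
  rintro σ' k ⟨hk, hσ', -, hsize, hout⟩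
  simp only [Set.univ_inter] at hsize hout
  exact ⟨by linarith, hσ', hsize, fun x y => by simp [hout, linkageFlow]⟩

theorem wp_maxFlow (hF : F.IsUnitCapacity) :
    wp maxFlow (fun σ' k => k ≤ 17 * n ^ 3 + 61 * n ^ 2 + 97 * n + 34 ∧
      ∃ p W, F.IsLinkage p ∅ ∧ F.IsBarrier p W ∧ σ'.reg rN = (ends p ∅).ncard ∧
      ∀ x y, (σ'.cell e (.out x y) : ℝ≥0) = F.linkageFlow p x y) (F.input e) := by
  simp only [maxFlow, block, wp]
  refine wp_mono wp_setRegisters ?_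
  rintro σ k₁ ⟨hk₁, hσ, hmem⟩
  refine wp_mono (wp_initArrays hσ hmem) ?_
  rintro σ k₂ ⟨hk₂, hσ⟩
  refine wp_mono (wp_augmentAll hF hσ) ?_
  rintro σ k₃ ⟨hk₃, p, W, hσ, hp, hW⟩
  refine wp_mono (wp_clearLinks hσ) ?_
  rintro σ k₄ ⟨hk₄, hσ, hlink⟩
  refine wp_mono (wp_writePaths hσ hlink) ?_
  rintro σ k₅ ⟨hk₅, hσ, hlink, hout⟩
  refine wp_mono (wp_writeEnds hσ hlink hout) ?_
  rintro σ k₆ ⟨hk₆, hσ, hsize, hout⟩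
  refine ⟨?_, p, W, hp, hW, by simp [hsize, hσ.zero], hout⟩
  linarith

end RAMProgram

namespace FlowNetwork

variable {N : Type u} {F : FlowNetwork N}

theorem IsUnitCapacity.exists_isLinkage_isBarrier [Finite N] (hF : F.IsUnitCapacity) :
    ∃ p W, F.IsLinkage p ∅ ∧ F.IsBarrier p W := by
  obtain ⟨n, ⟨e⟩⟩ := Finite.exists_equiv_fin N
  obtain ⟨-, -, -, -, p, W, hp, hW, -⟩ :=
    RAMProgram.exists_exec_of_wp (RAMProgram.wp_maxFlow (e := e) hF)
  exact ⟨p, W, hp, hW⟩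

theorem exists_maxFlow_program : ∃ (P : RAMProgram) (C : ℕ),
    ∀ {N : Type u} [Fintype N] (F : FlowNetwork N), F.IsUnitCapacity → ∀ (n : ℕ) (e : N ≃ Fin n),
      ∃ σ k, RAMExec P (F.input e) σ k ∧ F.IsOutput e σ ∧ k ≤ C * n ^ 3 := by
  refine ⟨RAMProgram.maxFlow, 209, fun F hF n e => ?_⟩
  obtain ⟨σ, k, hexec, hk, p, W, hp, hW, hsize, hout⟩ :=
    RAMProgram.exists_exec_of_wp (RAMProgram.wp_maxFlow (e := e) hF)
  have hn : 0 < n := (e F.source).pos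
  have hn₁ : n ≤ n ^ 3 := Nat.le_self_pow (by simp) n
  have hn₂ : n ^ 2 ≤ n ^ 3 := Nat.pow_le_pow_right hn (by simp)
  refine ⟨σ, k, hexec, ⟨F.linkageFlow p, hp.isMaxFlow hF hW, ?_, fun i j => ?_⟩, by omega⟩
  · rw [hsize, hp.size_linkageFlow]
  · simpa [RAMState.cell, MemCell.addr_out] using hout (e.symm i) (e.symm j)

end FlowNetwork

theorem theorem8 :
    (∀ (V : Type u) [Fintype V] (G : MixedGraph V),
      (G.HTCInfiniteToOne ↔
        ∃ f : G.FlowNode → G.FlowNode → ℝ≥0, G.flowNetwork.IsMaxFlow f ∧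
          G.flowNetwork.size f < (G.numDirected : ℝ≥0)) ∧
      G.numDirected = ∑ v, (G.pa v).ncard ∧
      2 * G.numReciprocal ≤ G.numDirected) ∧
    ∃ (P : RAMProgram) (C : ℕ),
      ∀ (V : Type u) [Fintype V] [Nonempty V] (G : MixedGraph V)
        (n : ℕ) (e : G.FlowNode ≃ Fin n),
        ∃ (σ : RAMState) (k : ℕ),
          RAMExec P (G.flowNetwork.input e) σ k ∧
          G.flowNetwork.IsOutput e σ ∧
          k ≤ C * (Fintype.card V ^ 3 * (Fintype.card V + G.numReciprocal) ^ 3) := by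
  refine ⟨fun V _ G => ⟨?_, G.numDirected_eq_sum, G.two_mul_numReciprocal_le⟩, ?_⟩
  · obtain ⟨p, W, hp, hW⟩ := G.isUnitCapacity_flowNetwork.exists_isLinkage_isBarrier
    rw [MixedGraph.htcInfiniteToOne_iff_ncard_ends_lt hp hW]
    exact (hp.exists_isMaxFlow_size_lt_iff G.isUnitCapacity_flowNetwork hW).symm
  · obtain ⟨P, C, hP⟩ := FlowNetwork.exists_maxFlow_program.{u}
    refine ⟨P, 64 * C, fun V _ _ G n e => ?_⟩
    obtain ⟨σ, k, hexec, hσ, hk⟩ := hP G.flowNetwork G.isUnitCapacity_flowNetwork n e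
    refine ⟨σ, k, hexec, hσ, hk.trans ?_⟩
    have hn : n ≤ 4 * (Fintype.card V * (Fintype.card V + G.numReciprocal)) := calc
      n = Fintype.card G.FlowNode := by simp [Fintype.card_congr e]
      _ ≤ 4 * Fintype.card V ^ 2 := G.card_flowNode_le
      _ ≤ _ := by rw [sq]; gcongr; exact Nat.le_add_right ..
    calc C * n ^ 3
        ≤ C * (4 * (Fintype.card V * (Fintype.card V + G.numReciprocal))) ^ 3 := by gcongr
      _ = _ := by ring
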